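/- Let $\mathcal E\to M$ be an exact Courant algebroid over a smooth manifold $M$, with anchor $\pi:\mathcal E\to TM$, pairing $\langle\cdot,\cdot\rangle$ and bracket $[\![\cdot,\cdot]\!]$. Let $G$ be a connected Lie group with Lie algebra $\mathfrak g$, let $\mathfrak a\to\mathfrak g$ be an exact Courant algebra (a real vector space $\mathfrak a$ with a bilinear bracket for which every left multiplication is a derivation, and a surjective bracket-preserving linear map $\mathfrak a\to\mathfrak g$ such that the bracket vanishes on its kernel $\mathfrak h$). Let $\Psi:\mathfrak a\to\Gamma(\mathcal E)$ be an extended action, that is, a bracket-preserving linear map which sends $\mathfrak h$ to closed $1$-forms (embedded in $\Gamma(\mathcal E)$ by $\pi^*$) and such that the infinitesimal actions $\pi\circ\Psi$ on $M$ and $\mathrm{ad}\circ\Psi$ on $\mathcal E$ integrate to a smooth action of $G$ on $M$ and a smooth action of $G$ on $\mathcal E$ by symmetries of the Courant algebroid which covers it. Put $K=\Psi(\mathfrak a)\subset\mathcal E$ and $\Delta_b=\pi(K+K^\perp)\subset TM$. Let $P$ be a leaf of $\Delta_b$ (or, more generally, a $G$-invariant, injectively immersed integral manifold of $\Delta_b$)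 over which $\Psi(\mathfrak h)$ has constant rank and on which $G$ acts smoothly, freely and properly, and let $$\mathcal E^{red}=\left.\frac{K^\perp|_P}{(K\cap K^\perp)|_P}\right/G\quad\text{over}\quad M^{red}=P/G$$ be the reduced bundle with its induced pairing and anchor and with the natural projection $p:K^\perp|_P\to\mathcal E^{red}$; its smooth sections are the $G$-invariant sections of $(K^\perp/(K\cap K^\perp))|_P$ that lift locally to smooth sections of $K^\perp|_P$. A generalized metric is a smooth, orthogonal, self-adjoint bundle endomorphism $\mathcal G$ with $\langle\mathcal Ge,e\rangle>0$ for $e\neq0$. Suppose that $K$ is isotropic over $P$ (so that $K\cap K^\perp=K$ over $P$), and that $\mathcal G$ is a generalized metric on $\mathcal E$ which is preserved by the extended action. Denote by $V_\pm$ the $\pm1$-eigenbundles of $\mathcal G$ and put $K^{\mathcal G}=K^\perp\cap\mathcal G K^\perp$. Then $\mathcal E^{red}$ is exact, i.e. $0\to T^*M^{red}\to\mathcal E^{red}\to TM^{red}\to0$ is exact, and $\mathcal G$ descends to $\mathcal E^{red}$: 1. over $P$, $K^{\mathcal G}$ is $\mathcal G$-invariant, and $p$ maps the fibre of $K^{\mathcal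 G}$ at each $x\in P$ isomorphically onto the fibre of $\mathcal E^{red}$ at the class of $x$; 2. there is exactly one endomorphism $\mathcal G^{red}$ of $\mathcal E^{red}$ with $\mathcal G^{red}\circ p=p\circ\mathcal G$ on $K^{\mathcal G}|_P$, and it is a generalized metric on $\mathcal E^{red}$; 3. the $\pm1$-eigenspaces of $\mathcal G^{red}$ are $V_\pm^{red}=p(V_\pm\cap K^\perp)$, and $\mathcal E^{red}=V_+^{red}\oplus V_-^{red}$. -/

import Mathlib

open Bundle Set Topology
open scoped Manifold ContDiff Bundle

set_option linter.unusedSectionVars false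

noncomputable section

/-! ### Directional derivatives and closed one-forms -/

section Calculus

variable {m : ℕ} {M : Type*} [TopologicalSpace M] [ChartedSpace (EuclideanSpace ℝ (Fin m)) M]

/-- The derivative `X f` of a function `f` in the direction of a tangent vector `X` at `x`. -/
def dirDeriv (f : M → ℝ) (x : M) (X : TangentSpace (𝓡 m) x) : ℝ :=
  mfderiv (𝓡 m) 𝓘(ℝ, ℝ) f x X

/-- Smooth vector fields on `M`. -/
abbrev SmoothVectorField (m : ℕ) (M : Type*) [TopologicalSpace M]
    [ChartedSpace (EuclideanSpace ℝ (Fin m)) M] [IsManifold (𝓡 m) ∞ M] :=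
  ContMDiffSection (𝓡 m) (EuclideanSpace ℝ (Fin m)) ∞ (fun x : M => TangentSpace (𝓡 m) x)

/-- A smooth closed one-form: `ξ(X)` is smooth for every smooth vector field `X`, and
`dξ(X, Y) = X ξ(Y) - Y ξ(X) - ξ([X, Y])` vanishes for all smooth vector fields `X`, `Y`. -/
structure IsClosedOneForm [IsManifold (𝓡 m) ∞ M]
    (ξ : ∀ x : M, TangentSpace (𝓡 m) x →ₗ[ℝ] ℝ) : Prop where
  smooth : ∀ X : SmoothVectorField m M, ContMDiff (𝓡 m) 𝓘(ℝ, ℝ) ∞ (fun x => ξ x (X x))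
  closed : ∀ (X Y : SmoothVectorField m M) (x : M),
    dirDeriv (fun y => ξ y (Y y)) x (X x) - dirDeriv (fun y => ξ y (X y)) x (Y x)
      - ξ x (VectorField.mlieBracket (𝓡 m) (fun y => X y) (fun y => Y y) x) = 0

end Calculus

/-! ### Courant algebroids -/

section CourantAlgebroid

variable (m : ℕ) {M : Type*} [TopologicalSpace M] [ChartedSpace (EuclideanSpace ℝ (Fin m)) M]
  [IsManifold (𝓡 m) ∞ M]
  (F : Type*) [NormedAddCommGroup F] [NormedSpace ℝ F]
  (E : M → Type*) [TopologicalSpace (TotalSpace F E)] [∀ x, TopologicalSpace (E x)]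
  [∀ x, AddCommGroup (E x)] [∀ x, Module ℝ (E x)]
  [FiberBundle F E] [VectorBundle ℝ F E] [ContMDiffVectorBundle ∞ F E (𝓡 m)]

/-- The space `Γ(E)` of smooth sections. -/
abbrev Sec := ContMDiffSection (𝓡 m) F ∞ E

variable {m F E}

/-- The product `f e` of a smooth function and a smooth section. -/
def smulSec (f : ContMDiffMap (𝓡 m) 𝓘(ℝ, ℝ) M ℝ ∞) (e : Sec m F E) : Sec m F E :=
  ⟨fun x => f x • e x, f.contMDiff.smul_section e.contMDiff⟩

variable (m F E)

/-- A Courant algebroid structure on the smooth vector bundle `E → M`: a nondegenerate symmetric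
pairing, an anchor `π : E → TM` and an `ℝ`-bilinear bracket on smooth sections. -/
structure CourantAlgebroid where
  pairing : ∀ x : M, E x →ₗ[ℝ] E x →ₗ[ℝ] ℝ
  pairing_symm : ∀ (x : M) (v w : E x), pairing x v w = pairing x w v
  pairing_nondegenerate : ∀ (x : M) (v : E x), (∀ w : E x, pairing x v w = 0) → v = 0
  pairing_smooth : ∀ e₁ e₂ : Sec m F E,
    ContMDiff (𝓡 m) 𝓘(ℝ, ℝ) ∞ (fun x => pairing x (e₁ x) (e₂ x))
  anchor : ∀ x : M, E x →ₗ[ℝ] TangentSpace (𝓡 m) x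
  anchor_smooth : ∀ e : Sec m F E,
    ContMDiff (𝓡 m) (𝓡 m).tangent ∞
      (fun x => (⟨x, anchor x (e x)⟩ : TangentBundle (𝓡 m) M))
  bracket : Sec m F E →ₗ[ℝ] Sec m F E →ₗ[ℝ] Sec m F E
  bracket_leibniz : ∀ e₁ e₂ e₃ : Sec m F E,
    bracket e₁ (bracket e₂ e₃) = bracket (bracket e₁ e₂) e₃ + bracket e₂ (bracket e₁ e₃)
  anchor_bracket : ∀ (e₁ e₂ : Sec m F E) (x : M),
    anchor x (bracket e₁ e₂ x) =
      VectorField.mlieBracket (𝓡 m) (fun y => anchor y (e₁ y)) (fun y => anchor y (e₂ y)) x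
  bracket_smul : ∀ (e₁ e₂ : Sec m F E) (f : ContMDiffMap (𝓡 m) 𝓘(ℝ, ℝ) M ℝ ∞) (x : M),
    bracket e₁ (smulSec f e₂) x =
      f x • bracket e₁ e₂ x + dirDeriv f x (anchor x (e₁ x)) • e₂ x
  anchor_pairing : ∀ (e₁ e₂ e₃ : Sec m F E) (x : M),
    dirDeriv (fun y => pairing y (e₂ y) (e₃ y)) x (anchor x (e₁ x)) =
      pairing x (bracket e₁ e₂ x) (e₃ x) + pairing x (e₂ x) (bracket e₁ e₃ x)
  /-- `⟦e, e⟧ = ½ π^* d⟨e, e⟩`, where `π^*` is defined by `⟨π^* ξ, w⟩ = ξ(π w)`. -/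
  bracket_self : ∀ (e : Sec m F E) (x : M) (w : E x),
    pairing x (bracket e e x) w =
      (1 / 2 : ℝ) * dirDeriv (fun y => pairing y (e y) (e y)) x (anchor x w)

variable {m F E}

/-- `v = π^* ξ` for the covector `ξ` at `x`, i.e. `⟨v, w⟩ = ξ(π w)` for all `w`. -/
def CourantAlgebroid.IsCoanchor (C : CourantAlgebroid m F E) {x : M}
    (ξ : TangentSpace (𝓡 m) x →ₗ[ℝ] ℝ) (v : E x) : Prop :=
  ∀ w : E x, C.pairing x v w = ξ (C.anchor x w)

/-- Exactness of `0 → T^*M → E → TM → 0`, with maps `π^*` and `π`. -/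
structure CourantAlgebroid.IsExact (C : CourantAlgebroid m F E) : Prop where
  coanchor_injective : ∀ (x : M) (ξ : TangentSpace (𝓡 m) x →ₗ[ℝ] ℝ),
    C.IsCoanchor ξ (0 : E x) → ξ = 0
  exact : ∀ (x : M) (v : E x),
    C.anchor x v = 0 ↔ ∃ ξ : TangentSpace (𝓡 m) x →ₗ[ℝ] ℝ, C.IsCoanchor ξ v
  anchor_surjective : ∀ x : M, Function.Surjective (C.anchor x)

/-- Smoothness over `U` of a (not necessarily continuous) section of `E`. -/
def SmoothSectionOn (m : ℕ) {M : Type*} [TopologicalSpace M]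
    [ChartedSpace (EuclideanSpace ℝ (Fin m)) M]
    (F : Type*) [NormedAddCommGroup F] [NormedSpace ℝ F]
    (E : M → Type*) [TopologicalSpace (TotalSpace F E)] [∀ x, TopologicalSpace (E x)]
    [FiberBundle F E]
    (U : Set M) (e : ∀ x, E x) : Prop :=
  ContMDiffOn (𝓡 m) ((𝓡 m).prod 𝓘(ℝ, F)) ∞ (fun x => (⟨x, e x⟩ : TotalSpace F E)) U

end CourantAlgebroid

/-- A generalized metric on a vector bundle `V → B` with a fibrewise pairing: a smooth orthogonal
self-adjoint bundle endomorphism `𝒢` with `⟨𝒢 v, v⟩ > 0` for `v ≠ 0`. The smooth structure of `V`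
enters through its smooth local sections. -/
structure IsGeneralizedMetric {B : Type*} [TopologicalSpace B] {V : B → Type*}
    [∀ b, AddCommGroup (V b)] [∀ b, Module ℝ (V b)]
    (pairing : ∀ b, V b →ₗ[ℝ] V b →ₗ[ℝ] ℝ) (SmoothOn : Set B → (∀ b, V b) → Prop)
    (𝒢 : ∀ b, V b →ₗ[ℝ] V b) : Prop where
  orthogonal : ∀ b (v w : V b), pairing b (𝒢 b v) (𝒢 b w) = pairing b v w
  selfAdjoint : ∀ b (v w : V b), pairing b (𝒢 b v) w = pairing b v (𝒢 b w)
  pos : ∀ b (v : V b), v ≠ 0 → 0 < pairing b (𝒢 b v) v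
  smooth : ∀ U : Set B, IsOpen U → ∀ σ : ∀ b, V b, SmoothOn U σ →
    SmoothOn U (fun b => 𝒢 b (σ b))

/-! ### Courant algebras and extended actions -/

/-- A Courant algebra `𝔞 → 𝔤`. -/
structure CourantAlgebra (𝔤 𝔞 : Type*) [LieRing 𝔤] [LieAlgebra ℝ 𝔤] [AddCommGroup 𝔞]
    [Module ℝ 𝔞] where
  bracket : 𝔞 →ₗ[ℝ] 𝔞 →ₗ[ℝ] 𝔞
  proj : 𝔞 →ₗ[ℝ] 𝔤
  leibniz : ∀ a b c : 𝔞, bracket a (bracket b c) = bracket (bracket a b) c + bracket b (bracket a c)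
  proj_bracket : ∀ a b : 𝔞, proj (bracket a b) = ⁅proj a, proj b⁆

/-- Exactness of a Courant algebra. -/
structure CourantAlgebra.IsExact {𝔤 𝔞 : Type*} [LieRing 𝔤] [LieAlgebra ℝ 𝔤] [AddCommGroup 𝔞]
    [Module ℝ 𝔞] (A : CourantAlgebra 𝔤 𝔞) : Prop where
  proj_surjective : Function.Surjective A.proj
  bracket_ker : ∀ a b : 𝔞, A.proj a = 0 → A.proj b = 0 → A.bracket a b = 0

instance instLieGroupMinSmoothness {k : ℕ} {G : Type*} [TopologicalSpace G]
    [ChartedSpace (EuclideanSpace ℝ (Fin k)) G] [Group G] [LieGroup (𝓡 k) ∞ G] :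
    LieGroup (𝓡 k) (minSmoothness ℝ 3) G := by
  rw [minSmoothness_of_isRCLikeNormedField]
  infer_instance

section ExtendedAction

variable {m : ℕ} {M : Type*} [TopologicalSpace M] [ChartedSpace (EuclideanSpace ℝ (Fin m)) M]
  [IsManifold (𝓡 m) ∞ M]
  {F : Type*} [NormedAddCommGroup F] [NormedSpace ℝ F]
  {E : M → Type*} [TopologicalSpace (TotalSpace F E)] [∀ x, TopologicalSpace (E x)]
  [∀ x, AddCommGroup (E x)] [∀ x, Module ℝ (E x)]
  [FiberBundle F E] [VectorBundle ℝ F E] [ContMDiffVectorBundle ∞ F E (𝓡 m)]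
  {k : ℕ} {G : Type*} [TopologicalSpace G] [ChartedSpace (EuclideanSpace ℝ (Fin k)) G] [Group G]
  [LieGroup (𝓡 k) ∞ G] [MulAction G M]
  {𝔞 : Type*} [AddCommGroup 𝔞] [Module ℝ 𝔞]

/-- An extended action on the Courant algebroid `C` of a Courant algebra `A` over the Lie algebra
`𝔤` of the Lie group `G`, which acts on `M`: a morphism of Courant algebras `Ψ : 𝔞 → Γ(E)` that maps
`𝔥 = ker(𝔞 → 𝔤)` into the closed one-forms, together with an action of `G` on `E` by symmetries of
the Courant algebroid, lifting the action on `M`, such that the two actions of `G` integrate the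
infinitesimal actions `π ∘ Ψ` on `M` and `ad ∘ Ψ` on `E`.

The infinitesimal generator of `γ ∈ 𝔤` at `x` is the velocity of `t ↦ exp(-tγ) x`, which is the sign
for which `𝔤 → Γ(TM)` preserves brackets. -/
structure ExtendedAction (C : CourantAlgebroid m F E)
    (A : CourantAlgebra (GroupLieAlgebra (𝓡 k) G) 𝔞) where
  Ψ : 𝔞 →ₗ[ℝ] Sec m F E
  map_bracket : ∀ a b : 𝔞, Ψ (A.bracket a b) = C.bracket (Ψ a) (Ψ b)
  closed_of_ker : ∀ a : 𝔞, A.proj a = 0 →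
    ∃ ξ : ∀ x : M, TangentSpace (𝓡 m) x →ₗ[ℝ] ℝ,
      IsClosedOneForm ξ ∧ ∀ x, C.IsCoanchor (ξ x) (Ψ a x)
  /-- The action of `g` on `E`, as a map from the fibre at `x` to the fibre at `g x`. -/
  act : ∀ (g : G) (x : M), E x →ₗ[ℝ] E (g • x)
  act_one : ∀ (x : M) (v : E x),
    (⟨(1 : G) • x, act 1 x v⟩ : TotalSpace F E) = ⟨x, v⟩
  act_mul : ∀ (g h : G) (x : M) (v : E x),
    (⟨(g * h) • x, act (g * h) x v⟩ : TotalSpace F E) =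
      ⟨g • h • x, act g (h • x) (act h x v)⟩
  act_smooth : ContMDiff ((𝓡 k).prod ((𝓡 m).prod 𝓘(ℝ, F))) ((𝓡 m).prod 𝓘(ℝ, F)) ∞
    (fun z : G × TotalSpace F E => (⟨z.1 • z.2.1, act z.1 z.2.1 z.2.2⟩ : TotalSpace F E))
  act_pairing : ∀ (g : G) (x : M) (v w : E x),
    C.pairing (g • x) (act g x v) (act g x w) = C.pairing x v w
  act_anchor : ∀ (g : G) (x : M) (v : E x),
    C.anchor (g • x) (act g x v) =
      mfderiv (𝓡 m) (𝓡 m) (fun y : M => g • y) x (C.anchor x v)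
  act_bracket : ∀ (g : G) (e₁ e₂ e₁' e₂' : Sec m F E),
    (∀ x, e₁' (g • x) = act g x (e₁ x)) → (∀ x, e₂' (g • x) = act g x (e₂ x)) →
    ∀ x, C.bracket e₁' e₂' (g • x) = act g x (C.bracket e₁ e₂ x)
  /-- `π(Ψ(a))` is the infinitesimal generator of the action of `G` on `M`. -/
  anchor_generator : ∀ (a : 𝔞) (x : M),
    C.anchor x (Ψ a x) = mfderiv (𝓡 k) (𝓡 m) (fun g : G => g⁻¹ • x) 1 (A.proj a)
  /-- `⟦Ψ(a), e⟧(x)` is the derivative at `g = 1`, in the direction of the image of `a` in `𝔤`, of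
  `(g e)(x) = g (e (g⁻¹ x))`. The equality is tested against all `w` in the fibre at `x`, using that
  `⟨g (e (g⁻¹ x)), w⟩ = ⟨e (g⁻¹ x), g⁻¹ w⟩`. -/
  ad_generator : ∀ (a : 𝔞) (e : Sec m F E) (x : M) (w : E x),
    C.pairing x (C.bracket (Ψ a) e x) w =
      dirDeriv (fun g : G => C.pairing (g⁻¹ • x) (e (g⁻¹ • x)) (act g⁻¹ x w)) 1 (A.proj a)

namespace ExtendedAction

variable {C : CourantAlgebroid m F E} {A : CourantAlgebra (GroupLieAlgebra (𝓡 k) G) 𝔞}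
  (S : ExtendedAction C A)

/-- The evaluation `a ↦ Ψ(a)(x)`. -/
def evalAt (x : M) : 𝔞 →ₗ[ℝ] E x where
  toFun a := S.Ψ a x
  map_add' a b := by simp
  map_smul' c a := by simp

/-- The distribution `K = Ψ(𝔞)`. -/
def K (x : M) : Submodule ℝ (E x) := LinearMap.range (S.evalAt x)

/-- The distribution `Ψ(𝔥)`, where `𝔥 = ker(𝔞 → 𝔤)`. -/
def Kh (x : M) : Submodule ℝ (E x) := (LinearMap.ker A.proj).map (S.evalAt x)

/-- The distribution `K^⊥`. -/
def Kperp (x : M) : Submodule ℝ (E x) where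
  carrier := {v | ∀ w ∈ S.K x, C.pairing x v w = 0}
  add_mem' hv hv' w hw := by simp [hv w hw, hv' w hw]
  zero_mem' w _ := by simp
  smul_mem' c v hv w hw := by simp [hv w hw]

/-- The distribution `Δ_b = π(K + K^⊥)` on `M`. -/
def bigDist (x : M) : Submodule ℝ (TangentSpace (𝓡 m) x) :=
  (S.K x ⊔ S.Kperp x).map (C.anchor x)

/-- `K^𝒢 = K^⊥ ∩ 𝒢 K^⊥`. -/
def KG (𝒢 : ∀ x, E x →ₗ[ℝ] E x) (x : M) : Submodule ℝ (E x) :=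
  S.Kperp x ⊓ (S.Kperp x).map (𝒢 x)

/-- The extended action preserves `𝒢`. -/
def Preserves (𝒢 : ∀ x, E x →ₗ[ℝ] E x) : Prop :=
  ∀ (g : G) (x : M) (v : E x), 𝒢 (g • x) (S.act g x v) = S.act g x (𝒢 x v)

/-- The fibre at `x` of `K^⊥ / (K ∩ K^⊥)`. -/
abbrev NormalFibre (x : M) : Type _ := S.Kperp x ⧸ (S.K x).comap (S.Kperp x).subtype

/-- The pairing induced on `K^⊥ / (K ∩ K^⊥)`. -/
def normalPairing (x : M) : S.NormalFibre x →ₗ[ℝ] S.NormalFibre x →ₗ[ℝ] ℝ :=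
  Submodule.liftQ _
    (LinearMap.flip (Submodule.liftQ _
      (((C.pairing x).domRestrict₁₂ (S.Kperp x) (S.Kperp x)).flip) (by
        intro w hw
        refine LinearMap.ext fun v => ?_
        exact v.2 w.1 hw)))
    (by
      intro w hw
      refine LinearMap.ext fun q => ?_
      obtain ⟨v, rfl⟩ := Submodule.Quotient.mk_surjective _ q
      change C.pairing x w.1 v.1 = 0
      rw [C.pairing_symm]
      exact v.2 w.1 hw)

theorem normalPairing_mk (x : M) (v w : S.Kperp x) :
    S.normalPairing x (Submodule.Quotient.mk v) (Submodule.Quotient.mk w) =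
      C.pairing x v.1 w.1 := rfl

/-! ### Integral manifolds of `Δ_b` and the reduced bundle -/

variable {d : ℕ} {P : Type*} [TopologicalSpace P] [ChartedSpace (EuclideanSpace ℝ (Fin d)) P]
  [MulAction G P]

/-- `ι : P → M` is a `G`-invariant immersed integral manifold of `Δ_b`: a `G`-equivariant injective
immersion with `dι(T_p P) = Δ_b(ι p)`, over which `Ψ(𝔥)` has constant rank. A leaf of `Δ_b` is a
maximal connected such manifold; connectedness and maximality are not required. -/
structure IsIntegralManifold (d : ℕ) {P : Type*} [TopologicalSpace P]
    [ChartedSpace (EuclideanSpace ℝ (Fin d)) P] [MulAction G P] (ι : P → M) : Prop where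
  smooth : ContMDiff (𝓡 d) (𝓡 m) ∞ ι
  injective : Function.Injective ι
  immersion : ∀ p, Function.Injective (mfderiv (𝓡 d) (𝓡 m) ι p)
  tangent : ∀ p, LinearMap.range (mfderiv (𝓡 d) (𝓡 m) ι p).toLinearMap = S.bigDist (ι p)
  equivariant : ∀ (g : G) (p : P), ι (g • p) = g • ι p
  constant_rank : ∃ r : ℕ, ∀ p, Module.finrank ℝ (S.Kh (ι p)) = r

/-- The projection `q : P → P / G`. -/
abbrev quot (G : Type*) {P : Type*} [Group G] [MulAction G P] (p : P) :
    MulAction.orbitRel.Quotient G P := Quotient.mk'' p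

variable {S} {ι : P → M}

theorem mk_add {x y : M} {v v' : E x} {w w' : E y}
    (h : (⟨x, v⟩ : TotalSpace F E) = ⟨y, w⟩) (h' : (⟨x, v'⟩ : TotalSpace F E) = ⟨y, w'⟩) :
    (⟨x, v + v'⟩ : TotalSpace F E) = ⟨y, w + w'⟩ := by
  cases h; cases h'; rfl

theorem mk_smul {x y : M} (c : ℝ) {v : E x} {w : E y}
    (h : (⟨x, v⟩ : TotalSpace F E) = ⟨y, w⟩) :
    (⟨x, c • v⟩ : TotalSpace F E) = ⟨y, c • w⟩ := by
  cases h; rfl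

/-- The fibre over `b ∈ P / G` of the reduced bundle `E^red = (K^⊥ / (K ∩ K^⊥))|_P / G`. A `G`-orbit
in the total space of `(K^⊥ / (K ∩ K^⊥))|_P` lying over the `G`-orbit `b` is encoded as the
`G`-equivariant section `s` of this bundle along the orbit `b` which it defines: if `p' = g p`, then
`s p` and `s p'` have representatives `v` and `w = g v`. -/
def RedFibre (hP : S.IsIntegralManifold d ι) (b : MulAction.orbitRel.Quotient G P) :
    Submodule ℝ (∀ p : {p : P // quot G p = b}, S.NormalFibre (ι p)) where
  carrier := {s | ∀ (g : G) (p p' : {p : P // quot G p = b}), p'.1 = g • p.1 →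
    ∃ (v : S.Kperp (ι p)) (w : S.Kperp (ι p')),
      s p = Submodule.Quotient.mk v ∧ s p' = Submodule.Quotient.mk w ∧
      (⟨ι p', w.1⟩ : TotalSpace F E) = ⟨g • ι p, S.act g (ι p) v.1⟩}
  add_mem' := by
    intro s t hs ht g p p' hp
    obtain ⟨v, w, h₁, h₂, h₃⟩ := hs g p p' hp
    obtain ⟨v', w', h₁', h₂', h₃'⟩ := ht g p p' hp
    refine ⟨v + v', w + w', ?_, ?_, ?_⟩
    · rw [Pi.add_apply, h₁, h₁', Submodule.Quotient.mk_add]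
    · rw [Pi.add_apply, h₂, h₂', Submodule.Quotient.mk_add]
    · simpa using mk_add h₃ h₃'
  zero_mem' := by
    intro g p p' hp
    refine ⟨0, 0, rfl, rfl, ?_⟩
    have h : ι p' = g • ι p := by rw [hp, hP.equivariant]
    simp only [ZeroMemClass.coe_zero, map_zero]
    rw [h]
  smul_mem' := by
    intro c s hs g p p' hp
    obtain ⟨v, w, h₁, h₂, h₃⟩ := hs g p p' hp
    refine ⟨c • v, c • w, ?_, ?_, ?_⟩
    · rw [Pi.smul_apply, h₁, Submodule.Quotient.mk_smul]
    · rw [Pi.smul_apply, h₂, Submodule.Quotient.mk_smul]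
    · simpa using mk_smul c h₃

/-- The value at `p` of an element of the reduced fibre over the orbit `b` of `p`. -/
def redEval (hP : S.IsIntegralManifold d ι) {b : MulAction.orbitRel.Quotient G P}
    (p : {p : P // quot G p = b}) : RedFibre hP b →ₗ[ℝ] S.NormalFibre (ι p) :=
  LinearMap.proj p ∘ₗ (RedFibre hP b).subtype

/-- The pairing on `E^red` induced by the pairing on `K^⊥`, computed at a point of the orbit; it does
not depend on the point, see `redPairing_eq`. -/
def redPairing (hP : S.IsIntegralManifold d ι) (b : MulAction.orbitRel.Quotient G P) :
    RedFibre hP b →ₗ[ℝ] RedFibre hP b →ₗ[ℝ] ℝ :=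
  (S.normalPairing (ι b.out)).compl₁₂
    (redEval hP ⟨b.out, Quotient.out_eq' b⟩) (redEval hP ⟨b.out, Quotient.out_eq' b⟩)

theorem pairing_eq_of_mk_eq {x y : M} {v v' : E x} {w w' : E y}
    (h : (⟨x, v⟩ : TotalSpace F E) = ⟨y, w⟩) (h' : (⟨x, v'⟩ : TotalSpace F E) = ⟨y, w'⟩) :
    C.pairing x v v' = C.pairing y w w' := by
  cases h; cases h'; rfl

theorem redPairing_eq (hP : S.IsIntegralManifold d ι) (b : MulAction.orbitRel.Quotient G P)
    (p : {p : P // quot G p = b}) (s t : RedFibre hP b) :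
    redPairing hP b s t = S.normalPairing (ι p) (redEval hP p s) (redEval hP p t) := by
  have hb : quot G b.out = b := Quotient.out_eq' b
  obtain ⟨g, hg⟩ : ∃ g : G, g • b.out = p.1 := by
    have h : quot G p.1 = quot G b.out := by rw [hb, p.2]
    exact MulAction.orbitRel_apply.mp (Quotient.exact h)
  obtain ⟨v, w, h₁, h₂, h₃⟩ := s.2 g ⟨b.out, hb⟩ p hg.symm
  obtain ⟨v', w', h₁', h₂', h₃'⟩ := t.2 g ⟨b.out, hb⟩ p hg.symm
  change S.normalPairing (ι b.out) (s.1 ⟨b.out, hb⟩) (t.1 ⟨b.out, hb⟩) =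
    S.normalPairing (ι p) (s.1 p) (t.1 p)
  rw [h₁, h₂, h₁', h₂', normalPairing_mk, normalPairing_mk, pairing_eq_of_mk_eq h₃ h₃',
    S.act_pairing]

/-- `s` is the image of `v ∈ K^⊥` at `ι p` under the projection from `K^⊥|_P` to `E^red`. -/
def IsProj (hP : S.IsIntegralManifold d ι) (p : P) (v : E (ι p))
    (s : RedFibre hP (quot G p)) : Prop :=
  ∃ hv : v ∈ S.Kperp (ι p), redEval hP ⟨p, rfl⟩ s = Submodule.Quotient.mk ⟨v, hv⟩

/-- The tangent space at `p` of the orbit `G p`. The tangent space of `P / G` at the class of `p` is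
the quotient of `T_p P` by it. -/
def orbitTangent (k : ℕ) (G : Type*) [TopologicalSpace G]
    [ChartedSpace (EuclideanSpace ℝ (Fin k)) G]
    [Group G] {d : ℕ} {P : Type*} [TopologicalSpace P]
    [ChartedSpace (EuclideanSpace ℝ (Fin d)) P] [MulAction G P] (p : P) :
    Submodule ℝ (TangentSpace (𝓡 d) p) :=
  LinearMap.range (mfderiv (𝓡 k) (𝓡 d) (fun g : G => g • p) 1).toLinearMap

/-- `X ∈ T_p P` represents the image of `s` under the anchor `π^red : E^red → T(P / G)`: it is
mapped by `dι` to `π v` for some `v ∈ K^⊥` which projects to `s`. -/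
def IsRedAnchor (hP : S.IsIntegralManifold d ι) (p : P) (s : RedFibre hP (quot G p))
    (X : TangentSpace (𝓡 d) p) : Prop :=
  ∃ v : E (ι p), IsProj hP p v s ∧ mfderiv (𝓡 d) (𝓡 m) ι p X = C.anchor (ι p) v

/-- Exactness of `0 → T^*(P / G) → E^red → T(P / G) → 0`, with maps `(π^red)^*` and `π^red`, at the
class of `p`. Covectors of `P / G` are the covectors of `P` that vanish on the orbit. -/
structure RedIsExactAt (hP : S.IsIntegralManifold d ι) (p : P) : Prop where
  coanchor_injective : ∀ ξ : TangentSpace (𝓡 d) p →ₗ[ℝ] ℝ, (∀ Y ∈ orbitTangent k G p, ξ Y = 0) →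
    (∀ t X, IsRedAnchor hP p t X → ξ X = 0) → ξ = 0
  exact : ∀ s : RedFibre hP (quot G p),
    (∃ X ∈ orbitTangent k G p, IsRedAnchor hP p s X) ↔
      ∃ ξ : TangentSpace (𝓡 d) p →ₗ[ℝ] ℝ, (∀ Y ∈ orbitTangent k G p, ξ Y = 0) ∧
        ∀ t X, IsRedAnchor hP p t X → redPairing hP (quot G p) s t = ξ X
  anchor_surjective : ∀ X : TangentSpace (𝓡 d) p, ∃ Y ∈ orbitTangent k G p,
    ∃ s, IsRedAnchor hP p s (X + Y)

/-- The operator `𝒢red` on `E^red` is the image of `𝒢` under the projection from `K^𝒢` to `E^red`. -/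
def Descends (hP : S.IsIntegralManifold d ι) (𝒢 : ∀ x, E x →ₗ[ℝ] E x)
    (𝒢red : ∀ b, RedFibre hP b →ₗ[ℝ] RedFibre hP b) : Prop :=
  ∀ p : P, ∀ v ∈ S.KG 𝒢 (ι p), ∀ s, IsProj hP p v s →
    IsProj hP p (𝒢 (ι p) v) (𝒢red (quot G p) s)

/-- A section `σ` of `E^red` is smooth over `U ⊆ P / G` if its pull-back to `P`, as a section of
`(K^⊥ / (K ∩ K^⊥))|_P`, is locally represented by smooth sections of `K^⊥|_P`. -/
def SmoothRedSectionOn (hP : S.IsIntegralManifold d ι)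
    (U : Set (MulAction.orbitRel.Quotient G P)) (σ : ∀ b, RedFibre hP b) : Prop :=
  ∀ p₀ : P, quot G p₀ ∈ U → ∃ W : Set P, IsOpen W ∧ p₀ ∈ W ∧
    ∃ e : ∀ p : P, E (ι p),
      ContMDiffOn (𝓡 d) ((𝓡 m).prod 𝓘(ℝ, F)) ∞ (fun p => (⟨ι p, e p⟩ : TotalSpace F E)) W ∧
      ∀ p ∈ W, IsProj hP p (e p) (σ (quot G p))

end ExtendedAction

end ExtendedAction

end

/-! ### Calculus: spans of constant rank, and orbit maps of free actions. -/

section Calculus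

/-! There are three ingredients: invariance of `K` along `P`, duality in the fibres, and a metric
complement of `K` in `K^⊥`.

Invariance of `K` under `G` is not assumed and has to be proved. Freeness on `P` makes the orbit
maps immersive (`injective_mfderiv_orbit_of_free`), so over `P` the anchor maps `K` onto the tangent
spaces of the orbits with kernel `Ψ(𝔥)`. Hence the rank of `K` is `dim G` plus the rank of `Ψ(𝔥)`, a
constant (`finrank_K`). Pulled back to one fibre of `E`, the sections `g⁻¹ Ψ(b)(g x)` have
derivatives `g⁻¹ Ψ([a, b])(g x)`, which lie in their own span. A span of constant rank that contains
the derivatives of its generators is locally constant, and `G` is connected, so `g K = K`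
(`map_act_K`). The action therefore passes to `K^⊥ / K` over `P`, and freeness identifies each fibre
of `E^red` with the fibre of `K^⊥ / K` at any point of the orbit (`redEval_injective`,
`exists_isProj`).

Exactness (`redIsExactAt`) is linear algebra in one fibre: isotropy turns `Δ_b` into `π(K^⊥)`, and
`K^⊥⊥ = K` does the rest.

The form `⟨𝒢 ·, ·⟩` is positive definite and `𝒢² = 1`, so `K^𝒢` consists of the vectors of `K^⊥`
that are orthogonal to `K` for this form. Thus `K^⊥ = K ⊕ K^𝒢`, the projection identifies `K^𝒢` with
`E^red` (`exists_equiv_KG`), and `𝒢` is carried across; its invariance makes the result independent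
of the point of the orbit (`exists_descends`). The algebraic properties are inherited from `𝒢`.
Smoothness follows because the `K^𝒢`-component of a smooth section is found by solving a Gram system
with smooth coefficients (`Descends.smooth`). -/

theorem exists_linearIndependent_comp_of_finrank_span {V α : Type*} [AddCommGroup V] [Module ℝ V]
    [FiniteDimensional ℝ V] (f : α → V) {n : ℕ}
    (hn : Module.finrank ℝ (Submodule.span ℝ (range f)) = n) :
    ∃ s : Fin n → α, LinearIndependent ℝ (fun i => f (s i)) := by
  subst hn
  obtain ⟨g, hg, -, hgi⟩ := Submodule.exists_fun_fin_finrank_span_eq ℝ (range f)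
  choose s hs using hg
  exact ⟨s, by simpa only [hs] using hgi⟩

/-- A family of differentiable maps whose pointwise span has constant rank and contains their
derivatives has locally constant span. -/
theorem eventually_span_range_eq {H V α : Type*} [NormedAddCommGroup H] [NormedSpace ℝ H]
    [NormedAddCommGroup V] [NormedSpace ℝ V] [FiniteDimensional ℝ V] {e : α → H → V} {U : Set H}
    (hU : IsOpen U) {x₀ : H} (hx₀ : x₀ ∈ U) (he : ∀ a, ∀ x ∈ U, DifferentiableAt ℝ (e a) x) {n : ℕ}
    (hr : ∀ x ∈ U, Module.finrank ℝ (Submodule.span ℝ (range fun a => e a x)) = n)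
    (hd : ∀ a, ∀ x ∈ U, ∀ v, fderiv ℝ (e a) x v ∈ Submodule.span ℝ (range fun a => e a x)) :
    ∀ᶠ x in 𝓝 x₀, Submodule.span ℝ (range fun a => e a x) =
      Submodule.span ℝ (range fun a => e a x₀) := by
  set W : H → Submodule ℝ V := fun x => Submodule.span ℝ (range fun a => e a x) with hW
  have heW : ∀ a x, e a x ∈ W x := fun a x => Submodule.subset_span ⟨a, rfl⟩
  obtain ⟨s, hs⟩ := exists_linearIndependent_comp_of_finrank_span (fun a => e a x₀) (hr x₀ hx₀)
  let L : H → (Fin n → ℝ) →L[ℝ] V := fun x =>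
    ∑ i, (ContinuousLinearMap.proj (R := ℝ) (φ := fun _ : Fin n => ℝ) i).smulRight (e (s i) x)
  have hL : ∀ x c, L x c = ∑ i, c i • e (s i) x := fun x c => by simp [L]
  have hLd : ∀ x ∈ U, DifferentiableAt ℝ L x := fun x hx =>
    DifferentiableAt.fun_sum fun i _ =>
      ((ContinuousLinearMap.smulRightL ℝ (Fin n → ℝ) V
        (ContinuousLinearMap.proj (R := ℝ) (φ := fun _ : Fin n => ℝ) i)).differentiableAt).comp x
          (he (s i) x hx)
  have hL₀ : LinearMap.ker (L x₀).toLinearMap = ⊥ := by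
    rw [LinearMap.ker_eq_bot']
    intro c hc
    have := Fintype.linearIndependent_iff.1 hs c (by rw [← hL]; exact hc)
    exact funext this
  -- A left inverse `Q` of the frame `L x₀` provides fixed linear coordinates on all nearby spans:
  -- `B x = Q ∘ L x` equals `1` at `x₀`, hence stays invertible nearby, and there `Q` is injective
  -- on `W x`.
  obtain ⟨Q₀, hQ₀⟩ := LinearMap.exists_leftInverse_of_injective _ hL₀
  let Q : V →L[ℝ] (Fin n → ℝ) := LinearMap.toContinuousLinearMap Q₀
  let B : H → (Fin n → ℝ) →L[ℝ] (Fin n → ℝ) := fun x => Q.comp (L x)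
  have hBd : ∀ x ∈ U, DifferentiableAt ℝ B x := fun x hx =>
    (differentiableAt_const Q).clm_comp (hLd x hx)
  have hB₀ : B x₀ = 1 := by
    ext1 c
    exact LinearMap.congr_fun hQ₀ c
  have hBu : ∀ᶠ x in 𝓝 x₀, IsUnit (B x) :=
    (hBd x₀ hx₀).continuousAt.eventually (by rw [hB₀]; exact Units.isOpen.mem_nhds isUnit_one)
  obtain ⟨ε, hε, hball⟩ := Metric.mem_nhds_iff.1 (Filter.inter_mem (hU.mem_nhds hx₀) hBu)
  have hBinv : ∀ x ∈ Metric.ball x₀ ε, ∀ c, B x (Ring.inverse (B x) c) = c := fun x hx c => by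
    rw [← mul_apply_eq_comp, Ring.mul_inverse_cancel _ (hball hx).2]; rfl
  have hBinv' : ∀ x ∈ Metric.ball x₀ ε, ∀ c, Ring.inverse (B x) (B x c) = c := fun x hx c => by
    rw [← mul_apply_eq_comp, Ring.inverse_mul_cancel _ (hball hx).2]; rfl
  have hLW : ∀ x c, L x c ∈ W x := fun x c => by
    rw [hL]; exact Submodule.sum_mem _ fun i _ => Submodule.smul_mem _ _ (heW _ _)
  have hrange : ∀ x ∈ Metric.ball x₀ ε, LinearMap.range (L x).toLinearMap = W x := by
    intro x hx
    refine Submodule.eq_of_le_of_finrank_eq ?_ ?_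
    · rintro _ ⟨c, rfl⟩
      exact hLW x c
    · rw [hr x (hball hx).1, LinearMap.finrank_range_of_inj, Module.finrank_fin_fun]
      intro c c' h
      have h' : B x c = B x c' := congrArg Q h
      rw [← hBinv' x hx c, h', hBinv' x hx]
  have hQ : ∀ x ∈ Metric.ball x₀ ε, ∀ w ∈ W x, Q w = 0 → w = 0 := by
    intro x hx w hw h
    rw [← hrange x hx] at hw
    obtain ⟨c, rfl⟩ := hw
    have h' : B x c = 0 := h
    have : c = 0 := by rw [← hBinv' x hx c, h', map_zero]
    simp [this]
  -- The normalised frame `L x ∘ (B x)⁻¹` does not move. Its derivative lies in `W x` by `hd`, and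
  -- `Q` kills it because `Q` of the frame is the constant `c`; injectivity of `Q` on `W x` makes it
  -- vanish.
  have hconst : ∀ x ∈ Metric.ball x₀ ε, ∀ c, L x (Ring.inverse (B x) c) = L x₀ c := by
    intro x hx c
    let u : H → (Fin n → ℝ) := fun x => Ring.inverse (B x) c
    have hu : ∀ x ∈ Metric.ball x₀ ε, DifferentiableAt ℝ u x := fun x hx =>
      ((differentiableAt_inverse (𝕜 := ℝ) (hball hx).2).comp x (hBd x (hball hx).1)).clm_apply
        (differentiableAt_const c)
    have hui : ∀ x ∈ Metric.ball x₀ ε, ∀ i, DifferentiableAt ℝ (fun x => u x i) x :=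
      fun x hx i => differentiableAt_pi.1 (hu x hx) i
    let f : H → V := fun x => ∑ i, u x i • e (s i) x
    have hf : ∀ x ∈ Metric.ball x₀ ε, HasFDerivAt f (∑ i, (u x i • fderiv ℝ (e (s i)) x +
        (fderiv ℝ (fun x => u x i) x).smulRight (e (s i) x))) x := fun x hx =>
      HasFDerivAt.fun_sum fun i _ =>
        (hui x hx i).hasFDerivAt.smul (he (s i) x (hball hx).1).hasFDerivAt
    have hQf : ∀ x ∈ Metric.ball x₀ ε, Q (f x) = c := fun x hx => by
      have : f x = L x (u x) := (hL _ _).symm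
      rw [this]
      exact hBinv x hx c
    have hf' : ∀ x ∈ Metric.ball x₀ ε, fderiv ℝ f x = 0 := by
      intro x hx
      ext1 v
      refine hQ x hx _ ?_ ?_
      · rw [(hf x hx).fderiv]
        simp only [sum_apply, add_apply, smul_apply, ContinuousLinearMap.smulRight_apply]
        exact Submodule.sum_mem _ fun i _ => Submodule.add_mem _
          (Submodule.smul_mem _ _ (hd _ _ (hball hx).1 _)) (Submodule.smul_mem _ _ (heW _ _))
      · have h1 : HasFDerivAt (fun x => Q (f x)) (Q.comp (fderiv ℝ f x)) x :=
          Q.hasFDerivAt.comp x (hf x hx).differentiableAt.hasFDerivAt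
        have h2 : HasFDerivAt (fun x => Q (f x)) (0 : H →L[ℝ] (Fin n → ℝ)) x :=
          (hasFDerivAt_const c x).congr_of_eventuallyEq
            (Filter.eventually_of_mem (Metric.isOpen_ball.mem_nhds hx) hQf)
        exact DFunLike.congr_fun (h1.unique h2) v
    have key : f x = f x₀ := Metric.isOpen_ball.is_const_of_fderiv_eq_zero
      (convex_ball x₀ ε).isPreconnected
      (fun x hx => (hf x hx).differentiableAt.differentiableWithinAt)
      (fun x hx => hf' x hx) hx (Metric.mem_ball_self hε)
    have hu₀ : u x₀ = c := by simp [u, hB₀]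
    calc L x (u x) = f x := hL _ _
      _ = f x₀ := key
      _ = L x₀ (u x₀) := (hL _ _).symm
      _ = L x₀ c := by rw [hu₀]
  filter_upwards [Metric.ball_mem_nhds x₀ hε] with x hx
  change W x = W x₀
  rw [← hrange x hx, ← hrange x₀ (Metric.mem_ball_self hε)]
  apply le_antisymm
  · rintro _ ⟨c, rfl⟩
    exact ⟨B x c, by simpa [hBinv' x hx] using (hconst x hx (B x c)).symm⟩
  · rintro _ ⟨c, rfl⟩
    exact ⟨_, hconst x hx c⟩

/-- Manifold version of `eventually_span_range_eq`. -/
theorem span_range_eq_of_mfderiv_mem {k : ℕ} {N : Type*} [TopologicalSpace N]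
    [ChartedSpace (EuclideanSpace ℝ (Fin k)) N] [IsManifold (𝓡 k) ∞ N] [PreconnectedSpace N]
    {V α : Type*} [NormedAddCommGroup V] [NormedSpace ℝ V] [FiniteDimensional ℝ V]
    {e : α → N → V} (he : ∀ a, MDifferentiable (𝓡 k) 𝓘(ℝ, V) (e a)) {n : ℕ}
    (hr : ∀ x, Module.finrank ℝ (Submodule.span ℝ (range fun a => e a x)) = n)
    (hd : ∀ a x (v : TangentSpace (𝓡 k) x), mfderiv (𝓡 k) 𝓘(ℝ, V) (e a) x v ∈
      Submodule.span ℝ (range fun a => e a x)) (x y : N) :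
    Submodule.span ℝ (range fun a => e a x) = Submodule.span ℝ (range fun a => e a y) := by
  have hloc : IsLocallyConstant fun x => Submodule.span ℝ (range fun a => e a x) := by
    rw [IsLocallyConstant.iff_eventually_eq]
    intro x₀
    let φ := extChartAt (𝓡 k) x₀
    have hφ : ∀ z ∈ φ.target, MDifferentiableAt 𝓘(ℝ, EuclideanSpace ℝ (Fin k)) (𝓡 k) φ.symm z :=
      fun z hz => ((contMDiffOn_extChartAt_symm (n := 1) x₀).contMDiffAt
        ((isOpen_extChartAt_target x₀).mem_nhds hz)).mdifferentiableAt one_ne_zero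
    have hfd : ∀ a, ∀ z ∈ φ.target, DifferentiableAt ℝ (e a ∘ φ.symm) z := fun a z hz =>
      mdifferentiableAt_iff_differentiableAt.1 ((he a _).comp z (hφ z hz))
    have key := eventually_span_range_eq (e := fun a => e a ∘ φ.symm)
      (isOpen_extChartAt_target (I := 𝓡 k) x₀) (mem_extChartAt_target x₀) hfd
      (fun z _ => hr (φ.symm z)) (by
        intro a z hz v
        rw [← mfderiv_eq_fderiv, mfderiv_comp z (he a _) (hφ z hz)]
        exact hd a (φ.symm z) _)
    have h2 := (continuousAt_extChartAt (I := 𝓡 k) x₀).eventually key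
    filter_upwards [h2, extChartAt_source_mem_nhds (I := 𝓡 k) x₀] with x hx hxs
    simp only [Function.comp_apply, φ, (extChartAt (𝓡 k) x₀).left_inv hxs,
      (extChartAt (𝓡 k) x₀).left_inv (mem_extChartAt_source x₀)] at hx
    exact hx
  exact hloc.apply_eq_of_preconnectedSpace x y

/-- Read in the chart at `f t₀`, the curve has zero derivative on an interval. This will show that a
curve tangent to the kernels of an orbit map stays in a stabiliser. -/
theorem eventually_eq_of_hasMFDerivAt_zero {d : ℕ} {P : Type*} [TopologicalSpace P]
    [ChartedSpace (EuclideanSpace ℝ (Fin d)) P] [IsManifold (𝓡 d) ∞ P] {f : ℝ → P} {t₀ : ℝ}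
    (hf : ∀ᶠ t in 𝓝 t₀, HasMFDerivAt 𝓘(ℝ, ℝ) (𝓡 d) f t 0) : ∀ᶠ t in 𝓝 t₀, f t = f t₀ := by
  let φ := extChartAt (𝓡 d) (f t₀)
  have hsrc : ∀ᶠ t in 𝓝 t₀, f t ∈ φ.source :=
    hf.self_of_nhds.continuousAt.eventually (extChartAt_source_mem_nhds (I := 𝓡 d) (f t₀))
  obtain ⟨ε, hε, hball⟩ := Metric.mem_nhds_iff.1 (Filter.inter_mem hf hsrc)
  have hd : ∀ t ∈ Metric.ball t₀ ε, HasFDerivAt (fun t => φ (f t)) (0 : ℝ →L[ℝ] _) t := by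
    intro t ht
    have h1 : MDifferentiableAt (𝓡 d) 𝓘(ℝ, EuclideanSpace ℝ (Fin d)) φ (f t) :=
      mdifferentiableAt_extChartAt (by simpa [φ] using (hball ht).2)
    have h2 := h1.hasMFDerivAt.comp t (hball ht).1
    rw [hasMFDerivAt_iff_hasFDerivAt] at h2
    refine h2.congr_fderiv ?_
    ext1
    exact map_zero (mfderiv (𝓡 d) 𝓘(ℝ, EuclideanSpace ℝ (Fin d)) φ (f t))
  filter_upwards [Metric.ball_mem_nhds t₀ hε] with t ht
  refine φ.injOn (hball ht).2 (mem_extChartAt_source (f t₀)) ?_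
  exact Metric.isOpen_ball.is_const_of_fderiv_eq_zero (𝕜 := ℝ) (f := fun t => φ (f t))
    (convex_ball t₀ ε).isPreconnected
    (fun t ht => (hd t ht).differentiableAt.differentiableWithinAt)
    (fun t ht => (hd t ht).fderiv) ht (Metric.mem_ball_self hε)

theorem contMDiff_orbit {k d : ℕ} {G P : Type*} [TopologicalSpace G]
    [ChartedSpace (EuclideanSpace ℝ (Fin k)) G] [TopologicalSpace P]
    [ChartedSpace (EuclideanSpace ℝ (Fin d)) P] [SMul G P] [ContMDiffSMul (𝓡 k) (𝓡 d) ∞ G P]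
    (p : P) : ContMDiff (𝓡 k) (𝓡 d) ∞ (fun g : G => g • p) :=
  (contMDiff_id (I := 𝓡 k) (M := G)).smul (contMDiff_const (c := p) (I' := 𝓡 d) (n := ∞))

/-- The orbit maps of a free smooth action are immersions at the identity. -/
theorem injective_mfderiv_orbit_of_free {k d : ℕ} {G P : Type*} [TopologicalSpace G]
    [ChartedSpace (EuclideanSpace ℝ (Fin k)) G] [Group G] [LieGroup (𝓡 k) ∞ G]
    [TopologicalSpace P] [ChartedSpace (EuclideanSpace ℝ (Fin d)) P] [IsManifold (𝓡 d) ∞ P]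
    [MulAction G P] [ContMDiffSMul (𝓡 k) (𝓡 d) ∞ G P]
    (hfree : ∀ (g : G) (p : P), g • p = p → g = 1) (p : P) :
    Function.Injective (mfderiv (𝓡 k) (𝓡 d) (fun g : G => g • p) 1) := by
  have horb : MDifferentiable (𝓡 k) (𝓡 d) (fun g : G => g • p) :=
    (contMDiff_orbit p).mdifferentiable (by simp)
  rw [injective_iff_map_eq_zero]
  intro X hX
  -- `γ` plays the part of `t ↦ exp(tX)`. Since `(g h) p = g (h p)`, a kernel vector at `1` spreads
  -- to a left-invariant field in the kernel everywhere; so `γ t • p` is constant, freeness forces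
  -- `γ = 1` near `0`, and the velocity `X` is zero.
  obtain ⟨γ, hγ₀, hγ⟩ := exists_isMIntegralCurveAt_of_contMDiffAt_boundaryless (I := 𝓡 k)
    (v := mulInvariantVectorField (I := 𝓡 k) (G := G) X) (x₀ := 1) 0
    ((contMDiffAt_mulInvariantVectorField (I := 𝓡 k) (G := G) X).of_le (by
      rw [minSmoothness_of_isRCLikeNormedField]; norm_num))
  have hker : ∀ g : G, mfderiv (𝓡 k) (𝓡 d) (fun g : G => g • p) g
      (mulInvariantVectorField (I := 𝓡 k) X g) = 0 := by
    intro g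
    have hmul : MDifferentiableAt (𝓡 k) (𝓡 k) (fun h : G => g * h) 1 :=
      (contMDiff_mul_left (I := 𝓡 k) (n := ∞) (a := g)).mdifferentiableAt (by simp)
    have hsm : MDifferentiableAt (𝓡 d) (𝓡 d) (fun q : P => g • q) ((1 : G) • p) :=
      (ContMDiffSMul.contMDiff_const_smul (I := 𝓡 k) (n := ∞) g).mdifferentiableAt (by simp)
    have h1 := mfderiv_comp (I := 𝓡 k) (I' := 𝓡 k) (I'' := 𝓡 d) (1 : G)
      (horb (g * 1)) hmul
    have h2 := mfderiv_comp (I := 𝓡 k) (I' := 𝓡 d) (I'' := 𝓡 d) (1 : G) hsm (horb 1)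
    have h3 : (fun g : G => g • p) ∘ (fun h : G => g * h) =
        (fun q : P => g • q) ∘ (fun g : G => g • p) := by
      ext h; simp [mul_smul]
    rw [h3, h2] at h1
    have h4 := DFunLike.congr_fun h1 X
    simp only [ContinuousLinearMap.comp_apply] at h4
    rw [hX, map_zero] at h4
    have h5 : ∀ g' : G, g' = g * 1 → ∀ Y : EuclideanSpace ℝ (Fin k),
        mfderiv (𝓡 k) (𝓡 d) (fun g : G => g • p) (g * 1) Y = 0 →
        mfderiv (𝓡 k) (𝓡 d) (fun g : G => g • p) g' Y = 0 := by
      rintro _ rfl Y hY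
      exact hY
    exact h5 g (mul_one g).symm _ h4.symm
  have hconst : ∀ᶠ t in 𝓝 (0 : ℝ), γ t • p = γ 0 • p := by
    refine eventually_eq_of_hasMFDerivAt_zero (d := d) (f := fun t => γ t • p) ?_
    filter_upwards [hγ] with t ht
    have h1 := ((horb (γ t)).hasMFDerivAt).comp t ht
    have h2 : (mfderiv (𝓡 k) (𝓡 d) (fun g : G => g • p) (γ t)).comp
        ((1 : ℝ →L[ℝ] ℝ).smulRight (mulInvariantVectorField (I := 𝓡 k) X (γ t))) =
        (0 : ℝ →L[ℝ] EuclideanSpace ℝ (Fin d)) := by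
      refine ContinuousLinearMap.ext fun r => ?_
      change mfderiv (𝓡 k) (𝓡 d) (fun g : G => g • p) (γ t)
        (r • mulInvariantVectorField (I := 𝓡 k) X (γ t)) = 0
      rw [map_smul, hker, smul_zero]
    exact h2 ▸ h1
  have hone : γ =ᶠ[𝓝 0] fun _ => (1 : G) := by
    filter_upwards [hconst] with t ht
    rw [hγ₀, one_smul] at ht
    exact hfree _ _ ht
  have h0 := (hasMFDerivAt_const (I := 𝓘(ℝ, ℝ)) (I' := 𝓡 k) (1 : G) (0 : ℝ)).congr_of_eventuallyEq
    hone
  have h1 := DFunLike.congr_fun (hasMFDerivAt_unique hγ.hasMFDerivAt h0) (1 : ℝ)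
  have h2 : ∀ g : G, g = 1 → mulInvariantVectorField (I := 𝓡 k) X g =
      (0 : EuclideanSpace ℝ (Fin k)) → X = 0 := by
    rintro _ rfl h
    have h3 : (fun g : G => 1 * g) = id := by ext; simp
    rw [mulInvariantVectorField, h3, mfderiv_id] at h
    exact h
  refine h2 (γ 0) hγ₀ ?_
  have h4 : (1 : ℝ) • mulInvariantVectorField (I := 𝓡 k) X (γ 0) =
      (0 : EuclideanSpace ℝ (Fin k)) := h1
  rwa [one_smul] at h4

end Calculus

/-! ### Smooth sections of `E` along a map into `M`. -/

section Along

variable {m : ℕ} {M : Type*} [TopologicalSpace M] [ChartedSpace (EuclideanSpace ℝ (Fin m)) M]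
  [IsManifold (𝓡 m) ∞ M]
  {F : Type*} [NormedAddCommGroup F] [NormedSpace ℝ F]
  {E : M → Type*} [TopologicalSpace (TotalSpace F E)] [∀ x, TopologicalSpace (E x)]
  [∀ x, AddCommGroup (E x)] [∀ x, Module ℝ (E x)]
  [FiberBundle F E] [VectorBundle ℝ F E] [ContMDiffVectorBundle ∞ F E (𝓡 m)]
  {d : ℕ} {N : Type*} [TopologicalSpace N] [ChartedSpace (EuclideanSpace ℝ (Fin d)) N]

/-- Smoothness at `q` of a section `e` of `E` along the map `f`. -/
def SmoothAlongAt (m : ℕ) {M : Type*} [TopologicalSpace M]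
    [ChartedSpace (EuclideanSpace ℝ (Fin m)) M]
    (F : Type*) [NormedAddCommGroup F] [NormedSpace ℝ F]
    {E : M → Type*} [TopologicalSpace (TotalSpace F E)] [∀ x, TopologicalSpace (E x)]
    [FiberBundle F E] (d : ℕ) {N : Type*} [TopologicalSpace N]
    [ChartedSpace (EuclideanSpace ℝ (Fin d)) N] (f : N → M) (e : ∀ n, E (f n)) (q : N) : Prop :=
  ContMDiffAt (𝓡 d) ((𝓡 m).prod 𝓘(ℝ, F)) ∞ (fun n => (⟨f n, e n⟩ : TotalSpace F E)) q

variable {f : N → M} {q : N}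

/-- A trivialization at `f q` is linear on fibres, which reduces the claim to functions with values
in `F`. -/
theorem SmoothAlongAt.sum_smul {α : Type*} [Fintype α]
    (hf : ContMDiffAt (𝓡 d) (𝓡 m) ∞ f q) {c : α → N → ℝ} {e : α → ∀ n, E (f n)}
    (hc : ∀ i, ContMDiffAt (𝓡 d) 𝓘(ℝ, ℝ) ∞ (c i) q)
    (he : ∀ i, SmoothAlongAt m F d f (e i) q) :
    SmoothAlongAt m F d f (fun n => ∑ i, c i n • e i n) q := by
  set T := trivializationAt F E (f q) with hT
  have hq : f q ∈ T.baseSet := mem_baseSet_trivializationAt F E (f q)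
  have hiff : ∀ v : ∀ n, E (f n), SmoothAlongAt m F d f v q ↔
      ContMDiffAt (𝓡 d) 𝓘(ℝ, F) ∞ (fun n => (T ⟨f n, v n⟩).2) q := fun v => by
    rw [SmoothAlongAt, T.contMDiffAt_iff (T.mem_source.2 hq)]
    exact and_iff_right hf
  rw [hiff]
  have h1 : ContMDiffAt (𝓡 d) 𝓘(ℝ, F) ∞ (fun n => ∑ i, c i n • (T ⟨f n, e i n⟩).2) q :=
    ContMDiffAt.sum fun i _ => (hc i).smul ((hiff _).1 (he i))
  refine h1.congr_of_eventuallyEq ?_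
  filter_upwards [hf.continuousAt.eventually (T.open_baseSet.mem_nhds hq)] with n hn
  have h2 : ∀ v : E (f n), (T ⟨f n, v⟩).2 = T.linearEquivAt ℝ (f n) hn v := fun v => rfl
  simp only [h2, map_sum, map_smul]

theorem SmoothAlongAt.add (hf : ContMDiffAt (𝓡 d) (𝓡 m) ∞ f q) {e₁ e₂ : ∀ n, E (f n)}
    (h₁ : SmoothAlongAt m F d f e₁ q) (h₂ : SmoothAlongAt m F d f e₂ q) :
    SmoothAlongAt m F d f (fun n => e₁ n + e₂ n) q := by
  have := SmoothAlongAt.sum_smul (α := Bool) hf (c := fun _ _ => 1)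
    (e := fun b n => if b then e₁ n else e₂ n) (fun _ => contMDiffAt_const)
    (fun b => by cases b <;> simpa)
  simpa using this

theorem SmoothAlongAt.comp_section {U : Set M} (hU : IsOpen U) {σ : ∀ x, E x}
    (hσ : SmoothSectionOn m F E U σ) (hf : ContMDiffAt (𝓡 d) (𝓡 m) ∞ f q) (hq : f q ∈ U) :
    SmoothAlongAt m F d f (fun n => σ (f n)) q :=
  ContMDiffAt.comp q (hσ.contMDiffAt (hU.mem_nhds hq)) hf

variable [FiniteDimensional ℝ F]

/-- A smooth section along `f` is a combination of a local frame with smooth coefficients. -/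
theorem SmoothAlongAt.exists_eq_sum_localFrame (hf : ContMDiffAt (𝓡 d) (𝓡 m) ∞ f q)
    {e : ∀ n, E (f n)} (he : SmoothAlongAt m F d f e q) :
    ∃ c : Fin (Module.finrank ℝ F) → N → ℝ, (∀ i, ContMDiffAt (𝓡 d) 𝓘(ℝ, ℝ) ∞ (c i) q) ∧
      ∀ᶠ n in 𝓝 q, e n = ∑ i, c i n •
        (trivializationAt F E (f q)).localFrame (Module.finBasis ℝ F) i (f n) := by
  set T := trivializationAt F E (f q) with hT
  set b := Module.finBasis ℝ F
  have hq : f q ∈ T.baseSet := mem_baseSet_trivializationAt F E (f q)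
  refine ⟨fun i n => b.repr (T ⟨f n, e n⟩).2 i, fun i => ?_, ?_⟩
  · have h1 := ((T.contMDiffAt_iff (T.mem_source.2 hq)).1 he).2
    have h2 : ContMDiff 𝓘(ℝ, F) 𝓘(ℝ, ℝ) ∞ (LinearMap.toContinuousLinearMap (b.coord i)) :=
      ContinuousLinearMap.contMDiff _
    exact h2.contMDiffAt.comp q h1
  · filter_upwards [hf.continuousAt.eventually (T.open_baseSet.mem_nhds hq)] with n hn
    have hb : ∀ i, T.linearEquivAt ℝ (f n) hn ((trivializationAt F E (f q)).localFrame b i (f n)) =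
        b i := fun i => by
      have h := T.localFrame_apply_of_mem_baseSet (𝕜 := ℝ) b (i := i) hn
      rw [Bundle.Trivialization.basisAt, Module.Basis.map_apply] at h
      exact (congrArg _ h).trans (LinearEquiv.apply_symm_apply _ _)
    apply (T.linearEquivAt ℝ (f n) hn).injective
    simp only [map_sum, map_smul, hb]
    exact (b.sum_repr _).symm

/-- A local smooth section agrees near a point with a global one. -/
theorem exists_sec_eventuallyEq [T2Space M] {U : Set M} (hU : IsOpen U) {σ : ∀ x, E x}
    (hσ : SmoothSectionOn m F E U σ) {x₀ : M} (hx₀ : x₀ ∈ U) :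
    ∃ s : Sec m F E, ∀ᶠ x in 𝓝 x₀, s x = σ x := by
  obtain ⟨ψ, -, hψ⟩ := (SmoothBumpFunction.nhds_basis_tsupport (I := 𝓡 m) x₀).mem_iff.1
    (hU.mem_nhds hx₀)
  refine ⟨⟨fun x => ψ x • σ x, ContMDiffOn.smul_section_of_tsupport
    ψ.contMDiff.contMDiffOn hU hψ hσ⟩, ?_⟩
  filter_upwards [ψ.eventuallyEq_one] with x hx
  change ψ x • σ x = σ x
  rw [hx]
  exact one_smul _ _

/-- `pairing_smooth` only concerns global sections of `E`. Both arguments are expanded in a local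
frame, and the frame is replaced near `f q` by global sections cut off with bump functions. -/
theorem CourantAlgebroid.contMDiffAt_pairing [T2Space M] (C : CourantAlgebroid m F E)
    (hf : ContMDiffAt (𝓡 d) (𝓡 m) ∞ f q) {e₁ e₂ : ∀ n, E (f n)}
    (h₁ : SmoothAlongAt m F d f e₁ q) (h₂ : SmoothAlongAt m F d f e₂ q) :
    ContMDiffAt (𝓡 d) 𝓘(ℝ, ℝ) ∞ (fun n => C.pairing (f n) (e₁ n) (e₂ n)) q := by
  set T := trivializationAt F E (f q) with hT
  obtain ⟨c₁, hc₁, h₁⟩ := h₁.exists_eq_sum_localFrame hf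
  obtain ⟨c₂, hc₂, h₂⟩ := h₂.exists_eq_sum_localFrame hf
  choose s hs using fun i => exists_sec_eventuallyEq (m := m) T.open_baseSet
    (T.contMDiffOn_localFrame_baseSet (I := 𝓡 m) ∞ (Module.finBasis ℝ F) i)
    (mem_baseSet_trivializationAt F E (f q))
  have h : ContMDiffAt (𝓡 d) 𝓘(ℝ, ℝ) ∞ (fun n => ∑ i, ∑ j, c₁ i n * (c₂ j n *
      C.pairing (f n) (s i (f n)) (s j (f n)))) q :=
    ContMDiffAt.sum fun i _ => ContMDiffAt.sum fun j _ => (hc₁ i).mul ((hc₂ j).mul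
      ((C.pairing_smooth (s i) (s j)).contMDiffAt.comp q hf))
  refine h.congr_of_eventuallyEq ?_
  filter_upwards [h₁, h₂, hf.continuousAt.eventually (Filter.eventually_all.2 hs)] with n h₁ h₂ h₃
  simp only [h₁, h₂, h₃, map_sum, map_smul, LinearMap.sum_apply, LinearMap.smul_apply, smul_eq_mul,
    Finset.mul_sum]
  rw [Finset.sum_comm]
  refine Finset.sum_congr rfl fun i _ => Finset.sum_congr rfl fun j _ => ?_
  ring

/-- The same expansion in a frame; smoothness of `𝒢` is given on local sections, so the frame needs
no extension. -/
theorem IsGeneralizedMetric.smoothAlongAt {pairing : ∀ x, E x →ₗ[ℝ] E x →ₗ[ℝ] ℝ}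
    {𝒢 : ∀ x, E x →ₗ[ℝ] E x} (h𝒢 : IsGeneralizedMetric pairing (SmoothSectionOn m F E) 𝒢)
    (hf : ContMDiffAt (𝓡 d) (𝓡 m) ∞ f q) {e : ∀ n, E (f n)} (he : SmoothAlongAt m F d f e q) :
    SmoothAlongAt m F d f (fun n => 𝒢 (f n) (e n)) q := by
  set T := trivializationAt F E (f q) with hT
  obtain ⟨c, hc, h⟩ := he.exists_eq_sum_localFrame hf
  have h1 := SmoothAlongAt.sum_smul hf hc
    (e := fun i n => 𝒢 (f n) (T.localFrame (Module.finBasis ℝ F) i (f n))) fun i =>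
      SmoothAlongAt.comp_section T.open_baseSet (h𝒢.smooth _ T.open_baseSet _
        (T.contMDiffOn_localFrame_baseSet (I := 𝓡 m) ∞ (Module.finBasis ℝ F) i)) hf
        (mem_baseSet_trivializationAt F E (f q))
  refine ContMDiffAt.congr_of_eventuallyEq h1 ?_
  filter_upwards [h] with n hn
  simp only [hn, map_sum, map_smul]
  rfl

end Along

/-! ### Invariance of `K` along an orbit of constant rank. -/

section Invariance

theorem finiteDimensional_fibre {B : Type*} [TopologicalSpace B]
    (F : Type*) [NormedAddCommGroup F] [NormedSpace ℝ F] [FiniteDimensional ℝ F]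
    (E : B → Type*) [TopologicalSpace (TotalSpace F E)] [∀ x, TopologicalSpace (E x)]
    [∀ x, AddCommGroup (E x)] [∀ x, Module ℝ (E x)] [FiberBundle F E] [VectorBundle ℝ F E] (x : B) :
    FiniteDimensional ℝ (E x) :=
  ((trivializationAt F E x).linearEquivAt ℝ x
    (mem_baseSet_trivializationAt F E x)).symm.finiteDimensional

namespace ExtendedAction

variable {m : ℕ} {M : Type*} [TopologicalSpace M] [ChartedSpace (EuclideanSpace ℝ (Fin m)) M]
  [IsManifold (𝓡 m) ∞ M]
  {F : Type*} [NormedAddCommGroup F] [NormedSpace ℝ F]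
  {E : M → Type*} [TopologicalSpace (TotalSpace F E)] [∀ x, TopologicalSpace (E x)]
  [∀ x, AddCommGroup (E x)] [∀ x, Module ℝ (E x)]
  [FiberBundle F E] [VectorBundle ℝ F E] [ContMDiffVectorBundle ∞ F E (𝓡 m)]
  {k : ℕ} {G : Type*} [TopologicalSpace G] [ChartedSpace (EuclideanSpace ℝ (Fin k)) G] [Group G]
  [LieGroup (𝓡 k) ∞ G] [MulAction G M]
  {𝔞 : Type*} [AddCommGroup 𝔞] [Module ℝ 𝔞]
  {C : CourantAlgebroid m F E} {A : CourantAlgebra (GroupLieAlgebra (𝓡 k) G) 𝔞}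
  (S : ExtendedAction C A)

theorem mk_section_eq (e : Sec m F E) {x y : M} (h : x = y) :
    (⟨x, e x⟩ : TotalSpace F E) = ⟨y, e y⟩ := by
  rw [h]

/-- The fibres at `l • x` and `g • h • x` are different types, so vectors are compared in the total
space; the free variable `l` absorbs group identities. -/
theorem mk_act_mul (g h : G) {l : G} (hl : l = g * h) (x : M) (v : E x) :
    (⟨l • x, S.act l x v⟩ : TotalSpace F E) = ⟨g • h • x, S.act g (h • x) (S.act h x v)⟩ := by
  subst hl
  exact S.act_mul g h x v

/-- An isometry of a nondegenerate pairing has no kernel. -/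
theorem act_injective (g : G) (x : M) : Function.Injective (S.act g x) := by
  rw [injective_iff_map_eq_zero]
  intro v hv
  refine C.pairing_nondegenerate x v fun w => ?_
  rw [← S.act_pairing g, hv, map_zero, LinearMap.zero_apply]

theorem act_surjective (g : G) (x : M) : Function.Surjective (S.act g x) := by
  intro w
  have h1 : (⟨g • x, w⟩ : TotalSpace F E) = ⟨g • g⁻¹ • g • x, S.act g _ (S.act g⁻¹ _ w)⟩ := by
    rw [← S.mk_act_mul g g⁻¹ (mul_inv_cancel g).symm, S.act_one]
  have h2 : ∀ (y : M) (_ : y = x) (u : E y), (⟨g • x, w⟩ : TotalSpace F E) = ⟨g • y, S.act g y u⟩ →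
      ∃ v, S.act g x v = w := by
    rintro _ rfl u hu
    exact ⟨u, (TotalSpace.mk_inj.1 hu).symm⟩
  exact h2 _ (inv_smul_smul g x) _ h1

theorem act_mem_Kperp {g : G} {x : M} (hK : (S.K x).map (S.act g x) = S.K (g • x)) {v : E x} :
    S.act g x v ∈ S.Kperp (g • x) ↔ v ∈ S.Kperp x := by
  constructor
  · intro hv w hw
    rw [← S.act_pairing g]
    exact hv _ (hK ▸ Submodule.mem_map_of_mem hw)
  · intro hv w hw
    rw [← hK] at hw
    obtain ⟨u, hu, rfl⟩ := hw
    rw [S.act_pairing]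
    exact hv u hu

theorem act_mem_K {g : G} {x : M} (hK : (S.K x).map (S.act g x) = S.K (g • x)) {v : E x} :
    S.act g x v ∈ S.K (g • x) ↔ v ∈ S.K x := by
  rw [← hK]
  exact (S.act_injective g x).mem_set_image

section Smooth

variable [T2Space M] [FiniteDimensional ℝ F] [ContMDiffSMul (𝓡 k) (𝓡 m) ∞ G M]

/-- By invariance of the pairing this is the coefficient against `w` of the pulled-back section `g⁻¹
e(g x)`, which takes values in the fixed fibre `E x`. -/
theorem contMDiff_pairing_act (e : Sec m F E) (x : M) (w : E x) :
    ContMDiff (𝓡 k) 𝓘(ℝ, ℝ) ∞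
      (fun g : G => C.pairing (g • x) (e (g • x)) (S.act g x w)) := by
  intro g
  refine C.contMDiffAt_pairing (contMDiff_orbit x).contMDiffAt ?_ ?_
  · exact e.contMDiff.contMDiffAt.comp g (contMDiff_orbit x).contMDiffAt
  · exact S.act_smooth.contMDiffAt.comp g (contMDiffAt_id.prodMk
      (contMDiffAt_const (c := (⟨x, w⟩ : TotalSpace F E))))

/-- The derivative of `g⁻¹ e (g x)` with respect to `g` is `g⁻¹ ⟦Ψ a, e⟧(g x)` for some `a`. -/
theorem exists_mfderiv_pairing_act (hA : A.IsExact) (x : M) (g₀ : G)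
    (v : TangentSpace (𝓡 k) g₀) : ∃ a : 𝔞, ∀ (e : Sec m F E) (w : E x),
      mfderiv (𝓡 k) 𝓘(ℝ, ℝ) (fun g : G => C.pairing (g • x) (e (g • x)) (S.act g x w)) g₀ v =
        C.pairing (g₀ • x) (C.bracket (S.Ψ a) e (g₀ • x)) (S.act g₀ x w) := by
  -- `ad_generator` differentiates at `1` only. As `ψ g₀ = 1` and `g = (ψ g)⁻¹ g₀`, the function
  -- factors through `ψ` and the function of `ad_generator` based at `g₀ • x`; `a` is a lift of
  -- `dψ(v)`, independent of `e` and `w`.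
  let ψ : G → G := fun g => g₀ * g⁻¹
  have hψ : ContMDiff (𝓡 k) (𝓡 k) ∞ ψ := contMDiff_const.mul (contMDiff_inv (𝓡 k) ∞)
  have hψ₀ : ψ g₀ = 1 := mul_inv_cancel g₀
  let v' : EuclideanSpace ℝ (Fin k) := mfderiv (𝓡 k) (𝓡 k) ψ g₀ v
  obtain ⟨a, ha⟩ := hA.proj_surjective v'
  refine ⟨a, fun e w => ?_⟩
  let φ : G → ℝ := fun g => C.pairing (g⁻¹ • g₀ • x) (e (g⁻¹ • g₀ • x))
    (S.act g⁻¹ (g₀ • x) (S.act g₀ x w))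
  have hφ : ContMDiff (𝓡 k) 𝓘(ℝ, ℝ) ∞ φ :=
    (S.contMDiff_pairing_act e (g₀ • x) (S.act g₀ x w)).comp (contMDiff_inv (𝓡 k) ∞)
  have hcomp : (fun g : G => C.pairing (g • x) (e (g • x)) (S.act g x w)) = φ ∘ ψ := by
    funext g
    refine pairing_eq_of_mk_eq (mk_section_eq e ?_) (S.mk_act_mul _ _ ?_ x w)
    · simp [ψ, mul_smul]
    · simp [ψ]
  have hφ' : ∀ h : G, h = 1 → ∀ u : EuclideanSpace ℝ (Fin k),
      mfderiv (𝓡 k) 𝓘(ℝ, ℝ) φ h u = mfderiv (𝓡 k) 𝓘(ℝ, ℝ) φ 1 u := by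
    rintro _ rfl u
    rfl
  rw [hcomp, mfderiv_comp g₀ (hφ.mdifferentiableAt (by simp)) (hψ.mdifferentiableAt (by simp)),
    S.ad_generator, ha]
  exact hφ' _ hψ₀ _

/-- If `K` has constant rank along the orbit of `x`, then it is invariant along this orbit. -/
theorem map_act_K [PreconnectedSpace G] (hA : A.IsExact) {x : M} {n : ℕ}
    (hn : ∀ g : G, Module.finrank ℝ (S.K (g • x)) = n) (g : G) :
    (S.K x).map (S.act g x) = S.K (g • x) := by
  have := finiteDimensional_fibre F E x
  let w := Module.finBasis ℝ (E x)
  -- `J g` pairs a vector at `g • x` with the translates of a basis of `E x`. It embeds all fibres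
  -- over the orbit into one coordinate space, where the subspaces `K` can be compared.
  let J : ∀ g : G, E (g • x) →ₗ[ℝ] (Fin (Module.finrank ℝ (E x)) → ℝ) := fun g =>
    LinearMap.pi fun i => (C.pairing (g • x)).flip (S.act g x (w i))
  have hJ : ∀ g, Function.Injective (J g) := by
    intro g
    rw [injective_iff_map_eq_zero]
    intro u hu
    refine C.pairing_nondegenerate _ u fun w' => ?_
    obtain ⟨w', rfl⟩ := S.act_surjective g x w'
    have h : (C.pairing (g • x) u) ∘ₗ (S.act g x) = 0 := w.ext fun i => congrFun hu i
    exact LinearMap.congr_fun h w'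
  let e : 𝔞 → G → (Fin (Module.finrank ℝ (E x)) → ℝ) := fun b g => J g (S.Ψ b (g • x))
  have hspan : ∀ g, Submodule.span ℝ (range fun b => e b g) = (S.K (g • x)).map (J g) := by
    intro g
    have : (range fun b => e b g) = ((S.K (g • x)).map (J g) : Set _) := by
      ext y
      constructor
      · rintro ⟨b, rfl⟩
        exact ⟨_, ⟨b, rfl⟩, rfl⟩
      · rintro ⟨_, ⟨b, rfl⟩, rfl⟩
        exact ⟨b, rfl⟩
    rw [this, Submodule.span_eq]
  have hei : ∀ b i, ContMDiff (𝓡 k) 𝓘(ℝ, ℝ) ∞ (fun g => e b g i) := fun b i =>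
    S.contMDiff_pairing_act (S.Ψ b) x (w i)
  have he : ∀ b, MDifferentiable (𝓡 k) 𝓘(ℝ, Fin (Module.finrank ℝ (E x)) → ℝ) (e b) := fun b =>
    (contMDiff_pi_space.2 (hei b)).mdifferentiable (by simp)
  have hconst := span_range_eq_of_mfderiv_mem he (n := n) (fun g => by
    rw [hspan, ← (Submodule.equivMapOfInjective (J g) (hJ g) _).finrank_eq, hn]) (by
      intro b g v
      obtain ⟨a, ha⟩ := S.exists_mfderiv_pairing_act hA x g v
      -- The derivative of the pull-back of `Ψ b` is that of `⟦Ψ a, Ψ b⟧ = Ψ([a, b])`, again a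
      -- generator of the span; one `a` serves all coordinates `i`.
      refine Submodule.subset_span ⟨A.bracket a b, ?_⟩
      funext i
      have hpr : MDifferentiableAt 𝓘(ℝ, Fin (Module.finrank ℝ (E x)) → ℝ) 𝓘(ℝ, ℝ)
          (ContinuousLinearMap.proj (R := ℝ) (φ := fun _ : Fin (Module.finrank ℝ (E x)) => ℝ) i)
          (e b g) := ContinuousLinearMap.mdifferentiableAt _
      have h1 := mfderiv_comp_apply g hpr (he b g) v
      rw [ContinuousLinearMap.mfderiv_eq] at h1
      refine Eq.trans ?_ h1
      refine Eq.trans ?_ (ha (S.Ψ b) (w i)).symm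
      change C.pairing (g • x) (S.Ψ (A.bracket a b) (g • x)) (S.act g x (w i)) = _
      rw [S.map_bracket]) g 1
  rw [hspan, hspan] at hconst
  -- Translating by `g` and then reading coordinates with `J g` is the same as reading them at the
  -- identity, so constancy of the spans becomes `g K = K`.
  have hkey : ∀ v : E x, ∀ v' : E ((1 : G) • x), (⟨(1 : G) • x, v'⟩ : TotalSpace F E) = ⟨x, v⟩ →
      J g (S.act g x v) = J 1 v' := by
    intro v v' h
    funext i
    change C.pairing (g • x) (S.act g x v) (S.act g x (w i)) =
      C.pairing ((1 : G) • x) v' (S.act 1 x (w i))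
    rw [S.act_pairing]
    exact (pairing_eq_of_mk_eq h (S.act_one x (w i))).symm
  have hK1 : ∀ b, J g (S.act g x (S.Ψ b x)) = J 1 (S.Ψ b ((1 : G) • x)) := fun b =>
    hkey _ _ (mk_section_eq _ (one_smul G x))
  apply le_antisymm
  · rintro _ ⟨_, ⟨b, rfl⟩, rfl⟩
    have h : J g (S.act g x (S.Ψ b x)) ∈ (S.K (g • x)).map (J g) := by
      rw [hconst, hK1]
      exact ⟨_, ⟨b, rfl⟩, rfl⟩
    exact (hJ g).mem_set_image.1 h
  · rintro _ ⟨b, rfl⟩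
    have h : J g (S.Ψ b (g • x)) ∈ (S.K ((1 : G) • x)).map (J 1) := by
      rw [← hconst]
      exact ⟨_, ⟨b, rfl⟩, rfl⟩
    obtain ⟨_, ⟨b', rfl⟩, hb'⟩ := h
    refine ⟨S.Ψ b' x, ⟨b', rfl⟩, hJ g ?_⟩
    rw [hK1]
    exact hb'

end Smooth

end ExtendedAction

end Invariance

/-! ### The rank of `K` over an integral manifold with free action. -/

section IntegralManifold

namespace ExtendedAction

variable {m : ℕ} {M : Type*} [TopologicalSpace M] [ChartedSpace (EuclideanSpace ℝ (Fin m)) M]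
  [IsManifold (𝓡 m) ∞ M]
  {F : Type*} [NormedAddCommGroup F] [NormedSpace ℝ F]
  {E : M → Type*} [TopologicalSpace (TotalSpace F E)] [∀ x, TopologicalSpace (E x)]
  [∀ x, AddCommGroup (E x)] [∀ x, Module ℝ (E x)]
  [FiberBundle F E] [VectorBundle ℝ F E] [ContMDiffVectorBundle ∞ F E (𝓡 m)]
  {k : ℕ} {G : Type*} [TopologicalSpace G] [ChartedSpace (EuclideanSpace ℝ (Fin k)) G] [Group G]
  [LieGroup (𝓡 k) ∞ G] [MulAction G M]
  {𝔞 : Type*} [AddCommGroup 𝔞] [Module ℝ 𝔞]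
  {C : CourantAlgebroid m F E} {A : CourantAlgebra (GroupLieAlgebra (𝓡 k) G) 𝔞}
  (S : ExtendedAction C A)
  {d : ℕ} {P : Type*} [TopologicalSpace P] [ChartedSpace (EuclideanSpace ℝ (Fin d)) P]
  [MulAction G P] {ι : P → M}

/-- The derivative at the identity of the inversion of a Lie group. -/
noncomputable def invDeriv (k : ℕ) (G : Type*) [TopologicalSpace G] [ChartedSpace (EuclideanSpace ℝ (Fin k)) G]
    [Group G] : GroupLieAlgebra (𝓡 k) G →L[ℝ] GroupLieAlgebra (𝓡 k) G :=
  let D : EuclideanSpace ℝ (Fin k) →L[ℝ] EuclideanSpace ℝ (Fin k) :=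
    mfderiv (𝓡 k) (𝓡 k) (fun g : G => g⁻¹) 1
  D

theorem hasMFDerivAt_inv_one : HasMFDerivAt (𝓡 k) (𝓡 k) (fun g : G => g⁻¹) 1
    (show EuclideanSpace ℝ (Fin k) →L[ℝ] EuclideanSpace ℝ (Fin k) from invDeriv k G) :=
  ((contMDiff_inv (𝓡 k) ∞).mdifferentiableAt (by simp)).hasMFDerivAt

theorem mfderiv_comp_inv_apply {n : ℕ} {N : Type*} [TopologicalSpace N]
    [ChartedSpace (EuclideanSpace ℝ (Fin n)) N] {f : G → N}
    (hf : MDifferentiableAt (𝓡 k) (𝓡 n) f 1) (u : GroupLieAlgebra (𝓡 k) G) :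
    mfderiv (𝓡 k) (𝓡 n) (fun g => f g⁻¹) 1 u =
      (mfderiv (𝓡 k) (𝓡 n) f 1 (invDeriv k G u) : EuclideanSpace ℝ (Fin n)) := by
  have h : ∀ h : G, h = 1 → HasMFDerivAt (𝓡 k) (𝓡 n) f h
      (show EuclideanSpace ℝ (Fin k) →L[ℝ] EuclideanSpace ℝ (Fin n) from
        mfderiv (𝓡 k) (𝓡 n) f 1) := by
    rintro _ rfl
    exact hf.hasMFDerivAt
  have h1 := (h _ inv_one).comp (1 : G) (hasMFDerivAt_inv_one (k := k) (G := G))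
  exact DFunLike.congr_fun h1.mfderiv u

/-- Generators are defined with `g⁻¹`, orbit tangents with `g`. To pass between them it suffices
that the derivative of inversion is a linear involution; its value `-1` is not needed. -/
theorem invDeriv_invDeriv (u : GroupLieAlgebra (𝓡 k) G) : invDeriv k G (invDeriv k G u) = u := by
  have h := mfderiv_comp_inv_apply (f := fun g : G => g⁻¹)
    ((contMDiff_inv (𝓡 k) ∞).mdifferentiableAt (by simp)) u
  have h2 : (fun g : G => (g⁻¹)⁻¹) = id := by ext; simp
  rw [h2, mfderiv_id] at h
  exact h.symm

variable {S} [ContMDiffSMul (𝓡 k) (𝓡 m) ∞ G M] [ContMDiffSMul (𝓡 k) (𝓡 d) ∞ G P]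

theorem mfderiv_orbit_map (hP : S.IsIntegralManifold d ι) (p : P)
    (u : GroupLieAlgebra (𝓡 k) G) :
    mfderiv (𝓡 k) (𝓡 m) (fun g : G => g • ι p) 1 u =
      (mfderiv (𝓡 d) (𝓡 m) ι p (show EuclideanSpace ℝ (Fin d) from
        mfderiv (𝓡 k) (𝓡 d) (fun g : G => g • p) 1 u) : EuclideanSpace ℝ (Fin m)) := by
  have h : ∀ q : P, q = p → HasMFDerivAt (𝓡 d) (𝓡 m) ι q
      (show EuclideanSpace ℝ (Fin d) →L[ℝ] EuclideanSpace ℝ (Fin m) from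
        mfderiv (𝓡 d) (𝓡 m) ι p) := by
    rintro _ rfl
    exact (hP.smooth.mdifferentiableAt (by simp)).hasMFDerivAt
  have h1 := (h _ (one_smul G p)).comp (1 : G)
    ((contMDiff_orbit (k := k) (G := G) p).mdifferentiableAt (by simp)).hasMFDerivAt
  have h2 : ι ∘ (fun g : G => g • p) = fun g : G => g • ι p := funext fun g => hP.equivariant g p
  rw [h2] at h1
  exact DFunLike.congr_fun h1.mfderiv u

theorem anchor_evalAt (hP : S.IsIntegralManifold d ι) (p : P) (a : 𝔞) :
    C.anchor (ι p) (S.Ψ a (ι p)) = mfderiv (𝓡 d) (𝓡 m) ι p (show EuclideanSpace ℝ (Fin d) from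
        mfderiv (𝓡 k) (𝓡 d) (fun g : G => g • p) 1 (invDeriv k G (A.proj a))) := by
  rw [S.anchor_generator]
  refine (mfderiv_comp_inv_apply ((contMDiff_orbit (ι p)).mdifferentiableAt (by simp)) _).trans ?_
  exact mfderiv_orbit_map hP p _

theorem exists_orbitTangent_of_mem_K (hP : S.IsIntegralManifold d ι) (p : P) {v : E (ι p)}
    (hv : v ∈ S.K (ι p)) : ∃ Y ∈ orbitTangent k G p,
      mfderiv (𝓡 d) (𝓡 m) ι p Y = C.anchor (ι p) v := by
  obtain ⟨a, rfl⟩ := hv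
  refine ⟨show EuclideanSpace ℝ (Fin d) from
    mfderiv (𝓡 k) (𝓡 d) (fun g : G => g • p) 1 (invDeriv k G (A.proj a)), ⟨_, rfl⟩, ?_⟩
  exact (anchor_evalAt hP p a).symm

theorem exists_mem_K_of_orbitTangent (hA : A.IsExact) (hP : S.IsIntegralManifold d ι) (p : P)
    {Y : TangentSpace (𝓡 d) p} (hY : Y ∈ orbitTangent k G p) :
    ∃ v ∈ S.K (ι p), C.anchor (ι p) v = mfderiv (𝓡 d) (𝓡 m) ι p Y := by
  obtain ⟨u, rfl⟩ := hY
  obtain ⟨a, ha⟩ := hA.proj_surjective (invDeriv k G u)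
  refine ⟨S.Ψ a (ι p), ⟨a, rfl⟩, ?_⟩
  rw [anchor_evalAt hP, ha, invDeriv_invDeriv]
  rfl

/-- Both `dι` and the differential of the orbit map in `P` are injective. Over `P`, therefore, only
`𝔥` can land in the kernel of the anchor. -/
theorem proj_eq_zero_of_anchor_eq_zero [IsManifold (𝓡 d) ∞ P]
    (hfree : ∀ (g : G) (p : P), g • p = p → g = 1)
    (hP : S.IsIntegralManifold d ι) (p : P) {a : 𝔞}
    (ha : C.anchor (ι p) (S.Ψ a (ι p)) = 0) : A.proj a = 0 := by
  rw [anchor_evalAt hP] at ha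
  have h1 := (injective_iff_map_eq_zero _).1 (hP.immersion p) _ ha
  have h2 := (injective_iff_map_eq_zero _).1 (injective_mfderiv_orbit_of_free hfree p) _ h1
  rw [← invDeriv_invDeriv (A.proj a), h2, map_zero]

theorem anchor_eq_zero_of_proj_eq_zero (hC : C.IsExact) {a : 𝔞} (ha : A.proj a = 0) (x : M) :
    C.anchor x (S.Ψ a x) = 0 := by
  obtain ⟨ξ, -, hξ⟩ := S.closed_of_ker a ha
  exact (hC.exact x _).2 ⟨ξ x, hξ x⟩

theorem finrank_orbitTangent [IsManifold (𝓡 d) ∞ P]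
    (hfree : ∀ (g : G) (p : P), g • p = p → g = 1) (p : P) :
    Module.finrank ℝ (orbitTangent (d := d) k G p) = k := by
  let f : EuclideanSpace ℝ (Fin k) →ₗ[ℝ] EuclideanSpace ℝ (Fin d) :=
    (mfderiv (𝓡 k) (𝓡 d) (fun g : G => g • p) 1).toLinearMap
  exact (LinearMap.finrank_range_of_inj (f := f) (injective_mfderiv_orbit_of_free hfree p)).trans
    finrank_euclideanSpace_fin

/-- Rank–nullity for the anchor restricted to `K`: its kernel is `Ψ(𝔥)` and its image is the
`k`-dimensional tangent space of the orbit, embedded by `dι`. -/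
theorem finrank_K [FiniteDimensional ℝ F] [IsManifold (𝓡 d) ∞ P]
    (hfree : ∀ (g : G) (p : P), g • p = p → g = 1) (hC : C.IsExact) (hA : A.IsExact)
    (hP : S.IsIntegralManifold d ι) (p : P) :
    Module.finrank ℝ (S.K (ι p)) = k + Module.finrank ℝ (S.Kh (ι p)) := by
  have := finiteDimensional_fibre F E (ι p)
  let f := (C.anchor (ι p)).domRestrict (S.K (ι p))
  have hker : (LinearMap.ker f).map (S.K (ι p)).subtype = S.Kh (ι p) := by
    ext v
    constructor
    · rintro ⟨⟨_, a, rfl⟩, ha, rfl⟩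
      exact ⟨a, proj_eq_zero_of_anchor_eq_zero hfree hP p ha, rfl⟩
    · rintro ⟨a, ha, rfl⟩
      exact ⟨⟨_, a, rfl⟩, anchor_eq_zero_of_proj_eq_zero hC ha _, rfl⟩
  have hrange : LinearMap.range f =
      (orbitTangent k G p).map (mfderiv (𝓡 d) (𝓡 m) ι p).toLinearMap := by
    ext X
    constructor
    · rintro ⟨⟨v, hv⟩, rfl⟩
      exact exists_orbitTangent_of_mem_K hP p hv
    · rintro ⟨Y, hY, rfl⟩
      obtain ⟨v, hv, h⟩ := exists_mem_K_of_orbitTangent hA hP p hY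
      exact ⟨⟨v, hv⟩, h⟩
  have h1 := LinearMap.finrank_range_add_finrank_ker f
  rw [← Submodule.finrank_map_subtype_eq, hker, hrange,
    ← (Submodule.equivMapOfInjective (mfderiv (𝓡 d) (𝓡 m) ι p).toLinearMap
      (hP.immersion p) _).finrank_eq, finrank_orbitTangent hfree] at h1
  exact h1.symm

variable (S) in
/-- The distribution `K` is `G`-invariant over `P` and has constant rank there. -/
structure IsInvariantAlong (ι : P → M) : Prop where
  rank : ∃ n : ℕ, ∀ p, Module.finrank ℝ (S.K (ι p)) = n
  map_act : ∀ (g : G) (p : P), (S.K (ι p)).map (S.act g (ι p)) = S.K (g • ι p)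

theorem IsIntegralManifold.isInvariantAlong [T2Space M] [FiniteDimensional ℝ F]
    [IsManifold (𝓡 d) ∞ P] [PreconnectedSpace G]
    (hfree : ∀ (g : G) (p : P), g • p = p → g = 1) (hC : C.IsExact) (hA : A.IsExact)
    (hP : S.IsIntegralManifold d ι) : S.IsInvariantAlong ι := by
  obtain ⟨r, hr⟩ := hP.constant_rank
  have h : ∀ p, Module.finrank ℝ (S.K (ι p)) = k + r := fun p => by
    rw [finrank_K hfree hC hA hP, hr]
  refine ⟨⟨k + r, h⟩, fun g p => S.map_act_K hA (n := k + r) (fun g => ?_) g⟩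
  rw [← hP.equivariant, h]

end ExtendedAction

end IntegralManifold

/-! ### Fibres of the reduced bundle and exactness. -/

section Reduction

/-- An injective map from `V` to its dual is onto by dimension. It is applied to the Courant pairing
and to `⟨𝒢 ·, ·⟩` on a subspace. -/
theorem exists_forall_eq_of_separating {V : Type*} [AddCommGroup V] [Module ℝ V]
    [FiniteDimensional ℝ V] (B : V →ₗ[ℝ] V →ₗ[ℝ] ℝ) (hB : ∀ v, (∀ w, B v w = 0) → v = 0)
    (φ : V →ₗ[ℝ] ℝ) : ∃ u, ∀ w, B u w = φ w := by
  have hinj : Function.Injective (B : V →ₗ[ℝ] Module.Dual ℝ V) :=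
    (injective_iff_map_eq_zero _).2 fun v hv => hB v fun w => by rw [hv, LinearMap.zero_apply]
  obtain ⟨u, hu⟩ := (LinearMap.injective_iff_surjective_of_finrank_eq_finrank
    (Subspace.dual_finrank_eq (K := ℝ) (V := V)).symm).1 hinj φ
  exact ⟨u, fun w => by rw [hu]⟩

namespace ExtendedAction

variable {m : ℕ} {M : Type*} [TopologicalSpace M] [ChartedSpace (EuclideanSpace ℝ (Fin m)) M]
  [IsManifold (𝓡 m) ∞ M]
  {F : Type*} [NormedAddCommGroup F] [NormedSpace ℝ F]
  {E : M → Type*} [TopologicalSpace (TotalSpace F E)] [∀ x, TopologicalSpace (E x)]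
  [∀ x, AddCommGroup (E x)] [∀ x, Module ℝ (E x)]
  [FiberBundle F E] [VectorBundle ℝ F E] [ContMDiffVectorBundle ∞ F E (𝓡 m)]
  {k : ℕ} {G : Type*} [TopologicalSpace G] [ChartedSpace (EuclideanSpace ℝ (Fin k)) G] [Group G]
  [LieGroup (𝓡 k) ∞ G] [MulAction G M]
  {𝔞 : Type*} [AddCommGroup 𝔞] [Module ℝ 𝔞]
  {C : CourantAlgebroid m F E} {A : CourantAlgebra (GroupLieAlgebra (𝓡 k) G) 𝔞}
  (S : ExtendedAction C A)
  {d : ℕ} {P : Type*} [TopologicalSpace P] [ChartedSpace (EuclideanSpace ℝ (Fin d)) P]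
  [MulAction G P] {ι : P → M}

theorem mem_K_of_forall_Kperp [FiniteDimensional ℝ F] {x : M} {v : E x}
    (hv : ∀ w ∈ S.Kperp x, C.pairing x v w = 0) : v ∈ S.K x := by
  have := finiteDimensional_fibre F E x
  let B : LinearMap.BilinForm ℝ (E x) := C.pairing x
  have hB : B.Nondegenerate := ⟨C.pairing_nondegenerate x, fun w h =>
    C.pairing_nondegenerate x w fun u => by rw [C.pairing_symm]; exact h u⟩
  have hrefl : B.IsRefl := fun u w h => (C.pairing_symm x w u).trans h
  rw [← LinearMap.BilinForm.orthogonal_orthogonal hB hrefl (S.K x)]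
  intro w hw
  refine (C.pairing_symm x w v).trans (hv w fun u hu => ?_)
  exact (C.pairing_symm x w u).trans (hw u hu)

theorem exists_mk_eq {x y : M} (h : x = y) (w : E y) :
    ∃ v : E x, (⟨x, v⟩ : TotalSpace F E) = ⟨y, w⟩ := by
  subst h
  exact ⟨w, rfl⟩

theorem mem_Kperp_of_mk_eq {x y : M} {v : E x} {w : E y}
    (h : (⟨x, v⟩ : TotalSpace F E) = ⟨y, w⟩) (hw : w ∈ S.Kperp y) : v ∈ S.Kperp x := by
  cases h
  exact hw

theorem mem_K_of_mk_eq {x y : M} {v : E x} {w : E y}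
    (h : (⟨x, v⟩ : TotalSpace F E) = ⟨y, w⟩) (hw : w ∈ S.K y) : v ∈ S.K x := by
  cases h
  exact hw

theorem mk_act_congr (g : G) {x y : M} {v : E x} {w : E y}
    (h : (⟨x, v⟩ : TotalSpace F E) = ⟨y, w⟩) :
    (⟨g • x, S.act g x v⟩ : TotalSpace F E) = ⟨g • y, S.act g y w⟩ := by
  cases h
  rfl

variable {S}

theorem exists_smul_of_quot_eq {p q : P} (h : quot G p = quot G q) : ∃ g : G, p = g • q := by
  obtain ⟨g, hg⟩ := MulAction.orbitRel_apply.mp (Quotient.exact h)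
  exact ⟨g, hg.symm⟩

/-- An equivariant section that vanishes at one point of the orbit has a representative in `K`
there, and invariance of `K` carries this to every other point. -/
theorem redEval_injective (hI : S.IsInvariantAlong ι) (hP : S.IsIntegralManifold d ι)
    {b : MulAction.orbitRel.Quotient G P} (p : {p : P // quot G p = b}) :
    Function.Injective (redEval hP p) := by
  rw [injective_iff_map_eq_zero]
  intro s hs
  apply Subtype.ext
  funext q
  obtain ⟨g, hg⟩ := exists_smul_of_quot_eq (q.2.trans p.2.symm)
  obtain ⟨v, w, hv, hw, h⟩ := s.2 g p q hg
  have hvK : v.1 ∈ S.K (ι p) := by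
    have : (Submodule.Quotient.mk v : S.NormalFibre (ι p)) = 0 := hv.symm.trans hs
    exact (Submodule.Quotient.mk_eq_zero ((S.K (ι p)).comap (S.Kperp (ι p)).subtype)).1 this
  change s.1 q = 0
  rw [hw, Submodule.Quotient.mk_eq_zero]
  exact S.mem_K_of_mk_eq h ((S.act_mem_K (hI.map_act g p)).2 hvK)

/-- The vector `v` is spread over the orbit by `g p ↦ g v`. Freeness makes `g` unique, hence the
section equivariant; invariance of `K` keeps it in `K^⊥`. -/
theorem exists_isProj (hfree : ∀ (g : G) (p : P), g • p = p → g = 1)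
    (hI : S.IsInvariantAlong ι) (hP : S.IsIntegralManifold d ι) (p : P) {v : E (ι p)}
    (hv : v ∈ S.Kperp (ι p)) : ∃ s, IsProj hP p v s := by
  have h : ∀ q : {q : P // quot G q = quot G p}, ∃ (g : G) (w : S.Kperp (ι q)), q.1 = g • p ∧
      (⟨ι q, w.1⟩ : TotalSpace F E) = ⟨g • ι p, S.act g (ι p) v⟩ := by
    intro q
    obtain ⟨g, hg⟩ := exists_smul_of_quot_eq q.2
    obtain ⟨w, hw⟩ := exists_mk_eq (F := F)
      (show ι q = g • ι p by rw [hg, hP.equivariant]) (S.act g (ι p) v)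
    exact ⟨g, ⟨w, S.mem_Kperp_of_mk_eq hw ((S.act_mem_Kperp (hI.map_act g p)).2 hv)⟩, hg, hw⟩
  choose g w hg hw using h
  have hcancel : ∀ a b : G, a • p = b • p → a = b := fun a b hab => by
    have := hfree (b⁻¹ * a) p (by rw [mul_smul, hab, inv_smul_smul])
    exact (inv_mul_eq_one.1 this).symm
  refine ⟨⟨fun q => Submodule.Quotient.mk (w q), ?_⟩, hv, ?_⟩
  · intro a q q' hq
    refine ⟨w q, w q', rfl, rfl, ?_⟩
    rw [hw q', S.mk_act_mul a (g q) (hcancel _ _ (by rw [mul_smul, ← hg, ← hg, hq]))]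
    exact S.mk_act_congr a (hw q).symm
  · change Submodule.Quotient.mk (w ⟨p, rfl⟩) = _
    congr 1
    apply Subtype.ext
    have h1 : g ⟨p, rfl⟩ = 1 := hfree _ p (hg ⟨p, rfl⟩).symm
    have h2 := hw ⟨p, rfl⟩
    rw [h1, S.act_one] at h2
    exact TotalSpace.mk_inj.1 h2

theorem isProj_unique (hI : S.IsInvariantAlong ι) {hP : S.IsIntegralManifold d ι} {p : P}
    {v : E (ι p)} {s t : RedFibre hP (quot G p)} (hs : IsProj hP p v s) (ht : IsProj hP p v t) :
    s = t := by
  obtain ⟨_, hs⟩ := hs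
  obtain ⟨_, ht⟩ := ht
  exact redEval_injective hI hP ⟨p, rfl⟩ (hs.trans ht.symm)

theorem exists_isProj_of_redFibre (hP : S.IsIntegralManifold d ι) {p : P}
    (s : RedFibre hP (quot G p)) : ∃ v ∈ S.Kperp (ι p), IsProj hP p v s := by
  obtain ⟨v, hv⟩ := Submodule.Quotient.mk_surjective _ (redEval hP ⟨p, rfl⟩ s)
  exact ⟨v.1, v.2, v.2, hv.symm⟩

section IsProj

variable {hP : S.IsIntegralManifold d ι} {p : P} {v w : E (ι p)} {s t : RedFibre hP (quot G p)}

theorem IsProj.mem (h : IsProj hP p v s) : v ∈ S.Kperp (ι p) := h.1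

theorem IsProj.add (hv : IsProj hP p v s) (hw : IsProj hP p w t) : IsProj hP p (v + w) (s + t) := by
  obtain ⟨hv, hs⟩ := hv
  obtain ⟨hw, ht⟩ := hw
  exact ⟨add_mem hv hw, by rw [map_add, hs, ht]; rfl⟩

theorem IsProj.smul (c : ℝ) (hv : IsProj hP p v s) : IsProj hP p (c • v) (c • s) := by
  obtain ⟨hv, hs⟩ := hv
  exact ⟨Submodule.smul_mem _ c hv, by rw [map_smul, hs]; rfl⟩

theorem IsProj.neg (hv : IsProj hP p v s) : IsProj hP p (-v) (-s) := by
  obtain ⟨hv, hs⟩ := hv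
  refine ⟨neg_mem hv, ?_⟩
  change -redEval hP ⟨p, rfl⟩ s = _
  rw [hs]
  rfl

theorem IsProj.sub_mem (hv : IsProj hP p v s) (hw : IsProj hP p w s) : v - w ∈ S.K (ι p) := by
  obtain ⟨hv, hs⟩ := hv
  obtain ⟨hw, ht⟩ := hw
  exact (Submodule.Quotient.eq ((S.K (ι p)).comap (S.Kperp (ι p)).subtype)).1 (hs.symm.trans ht)

theorem IsProj.of_sub_mem (hv : IsProj hP p v s) (hw : w ∈ S.Kperp (ι p))
    (h : v - w ∈ S.K (ι p)) : IsProj hP p w s := by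
  obtain ⟨hv, hs⟩ := hv
  exact ⟨hw, hs.trans ((Submodule.Quotient.eq _).2 h)⟩

theorem IsProj.redPairing_eq (hv : IsProj hP p v s) (hw : IsProj hP p w t) :
    redPairing hP (quot G p) s t = C.pairing (ι p) v w := by
  obtain ⟨hv, hs⟩ := hv
  obtain ⟨hw, ht⟩ := hw
  rw [ExtendedAction.redPairing_eq hP _ ⟨p, rfl⟩, hs, ht]
  rfl

end IsProj

/-- Exactness of the reduced Courant algebroid. -/
theorem redIsExactAt [FiniteDimensional ℝ F] [ContMDiffSMul (𝓡 k) (𝓡 m) ∞ G M]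
    [ContMDiffSMul (𝓡 k) (𝓡 d) ∞ G P]
    (hfree : ∀ (g : G) (p : P), g • p = p → g = 1) (hC : C.IsExact) (hA : A.IsExact)
    (hI : S.IsInvariantAlong ι) (hP : S.IsIntegralManifold d ι) (p : P)
    (hK : S.K (ι p) ≤ S.Kperp (ι p)) : RedIsExactAt hP p := by
  have := finiteDimensional_fibre F E (ι p)
  -- Isotropy gives `Δ_b = π(K^⊥)`, so every tangent vector of `P` lifts without an orbit
  -- correction.
  have hlift : ∀ X : TangentSpace (𝓡 d) p, ∃ s, IsRedAnchor hP p s X := by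
    intro X
    have hX : mfderiv (𝓡 d) (𝓡 m) ι p X ∈ S.bigDist (ι p) := by
      rw [← hP.tangent]
      exact ⟨X, rfl⟩
    rw [bigDist, sup_eq_right.2 hK] at hX
    obtain ⟨v, hv, h⟩ := hX
    obtain ⟨s, hs⟩ := exists_isProj hfree hI hP p hv
    exact ⟨s, v, hs, h.symm⟩
  refine ⟨fun ξ _ h => LinearMap.ext fun X => ?_, fun s => ⟨?_, ?_⟩, fun X => ?_⟩
  · obtain ⟨t, ht⟩ := hlift X
    exact h t X ht
  · rintro ⟨X, hX, v, hv, hvX⟩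
    obtain ⟨κ, hκ, hκX⟩ := exists_mem_K_of_orbitTangent hA hP p hX
    -- Subtracting `κ ∈ K` with the same anchor leaves a vector `π^* ξ` of `K^⊥`; being orthogonal
    -- to `K` means that `ξ` vanishes on the orbit, and `κ` does not affect pairings with `K^⊥`.
    obtain ⟨ξ, hξ⟩ := (hC.exact (ι p) (v - κ)).1 (by rw [map_sub, hκX, hvX, sub_self])
    refine ⟨ξ ∘ₗ (mfderiv (𝓡 d) (𝓡 m) ι p).toLinearMap, fun Y hY => ?_, ?_⟩
    · obtain ⟨κ', hκ', h⟩ := exists_mem_K_of_orbitTangent hA hP p hY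
      change ξ (mfderiv (𝓡 d) (𝓡 m) ι p Y) = 0
      rw [← h, ← hξ]
      exact sub_mem hv.mem (hK hκ) κ' hκ'
    · rintro t Z ⟨w, hw, hwZ⟩
      change _ = ξ (mfderiv (𝓡 d) (𝓡 m) ι p Z)
      rw [hwZ, ← hξ, hv.redPairing_eq hw, map_sub, LinearMap.sub_apply, C.pairing_symm _ κ w,
        hw.mem κ hκ, sub_zero]
  · rintro ⟨ξ, hξ, h⟩
    obtain ⟨v, -, hv⟩ := exists_isProj_of_redFibre hP s
    obtain ⟨r, hr⟩ := LinearMap.exists_leftInverse_of_injective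
      (mfderiv (𝓡 d) (𝓡 m) ι p).toLinearMap (LinearMap.ker_eq_bot.2 (hP.immersion p))
    have hr : ∀ Z, r (mfderiv (𝓡 d) (𝓡 m) ι p Z) = Z := fun Z => LinearMap.congr_fun hr Z
    -- `ξ ∘ r` extends `ξ` to a covector of `M`, and `u = π^*(ξ ∘ r)`. Then `v - u` is orthogonal to
    -- `K^⊥`, hence lies in `K`, and `π v = π(v - u)` is tangent to the orbit.
    obtain ⟨u, hu⟩ := exists_forall_eq_of_separating (C.pairing (ι p))
      (C.pairing_nondegenerate (ι p)) ((ξ ∘ₗ r) ∘ₗ C.anchor (ι p))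
    have hu₀ : C.anchor (ι p) u = 0 := (hC.exact (ι p) u).2 ⟨ξ ∘ₗ r, hu⟩
    have huK : u ∈ S.Kperp (ι p) := by
      intro κ hκ
      obtain ⟨Y, hY, hYκ⟩ := exists_orbitTangent_of_mem_K hP p hκ
      rw [hu]
      change ξ (r (C.anchor (ι p) κ)) = 0
      rw [← hYκ, hr, hξ Y hY]
    have hvu : v - u ∈ S.K (ι p) := by
      refine S.mem_K_of_forall_Kperp fun w hw => ?_
      obtain ⟨t, ht⟩ := exists_isProj hfree hI hP p hw
      have hwΔ : C.anchor (ι p) w ∈ S.bigDist (ι p) :=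
        Submodule.mem_map_of_mem (Submodule.mem_sup_right hw)
      rw [← hP.tangent] at hwΔ
      obtain ⟨Z, hZ⟩ := hwΔ
      have hZ : mfderiv (𝓡 d) (𝓡 m) ι p Z = C.anchor (ι p) w := hZ
      rw [map_sub, LinearMap.sub_apply, ← hv.redPairing_eq ht, h t Z ⟨w, ht, hZ⟩, hu]
      change ξ Z - ξ (r (C.anchor (ι p) w)) = 0
      rw [← hZ, hr, sub_self]
    obtain ⟨X, hX, hXv⟩ := exists_orbitTangent_of_mem_K hP p hvu
    refine ⟨X, hX, v, hv, ?_⟩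
    rw [hXv, map_sub, hu₀, sub_zero]
  · obtain ⟨s, hs⟩ := hlift X
    exact ⟨0, zero_mem _, s, by rwa [add_zero]⟩

end ExtendedAction

end Reduction

/-! ### `K^𝒢` as the metric complement of `K` in `K^⊥`. -/

section GeneralizedMetric

theorem contMDiffAt_det {d n : ℕ} {N : Type*} [TopologicalSpace N]
    [ChartedSpace (EuclideanSpace ℝ (Fin d)) N] {Γ : N → Matrix (Fin n) (Fin n) ℝ} {q : N}
    (hΓ : ∀ i j, ContMDiffAt (𝓡 d) 𝓘(ℝ, ℝ) ∞ (fun x => Γ x i j) q) :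
    ContMDiffAt (𝓡 d) 𝓘(ℝ, ℝ) ∞ (fun x => (Γ x).det) q := by
  simp only [Matrix.det_apply']
  exact ContMDiffAt.sum fun σ _ => contMDiffAt_const.mul (ContMDiffAt.prod fun i _ => hΓ _ _)

theorem contMDiffAt_cramer {d n : ℕ} {N : Type*} [TopologicalSpace N]
    [ChartedSpace (EuclideanSpace ℝ (Fin d)) N] {Γ : N → Matrix (Fin n) (Fin n) ℝ}
    {h : N → Fin n → ℝ} {q : N}
    (hΓ : ∀ i j, ContMDiffAt (𝓡 d) 𝓘(ℝ, ℝ) ∞ (fun x => Γ x i j) q)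
    (hh : ∀ i, ContMDiffAt (𝓡 d) 𝓘(ℝ, ℝ) ∞ (fun x => h x i) q) (i : Fin n) :
    ContMDiffAt (𝓡 d) 𝓘(ℝ, ℝ) ∞ (fun x => (Γ x).cramer (h x) i) q := by
  simp only [Matrix.cramer_apply]
  refine contMDiffAt_det fun j l => ?_
  by_cases hl : l = i
  · subst hl
    simpa using hh j
  · simpa [Matrix.updateCol_ne hl] using hΓ j l

namespace IsGeneralizedMetric

variable {B : Type*} [TopologicalSpace B] {V : B → Type*} [∀ b, AddCommGroup (V b)]
  [∀ b, Module ℝ (V b)] {pairing : ∀ b, V b →ₗ[ℝ] V b →ₗ[ℝ] ℝ}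
  {SmoothOn : Set B → (∀ b, V b) → Prop} {𝒢 : ∀ b, V b →ₗ[ℝ] V b}

theorem apply_apply (h𝒢 : IsGeneralizedMetric pairing SmoothOn 𝒢) {b : B}
    (hnd : ∀ v : V b, (∀ w, pairing b v w = 0) → v = 0) (v : V b) : 𝒢 b (𝒢 b v) = v := by
  rw [← sub_eq_zero]
  refine hnd _ fun w => ?_
  rw [map_sub, LinearMap.sub_apply, h𝒢.selfAdjoint, h𝒢.orthogonal, sub_self]

/-- The orthogonal projection to a subspace with respect to the metric `⟨𝒢 ·, ·⟩`. -/
theorem exists_mem_forall_pairing_sub_eq_zero (h𝒢 : IsGeneralizedMetric pairing SmoothOn 𝒢) {b : B}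
    (K : Submodule ℝ (V b)) [FiniteDimensional ℝ K] (v : V b) :
    ∃ κ ∈ K, ∀ w ∈ K, pairing b (𝒢 b (v - κ)) w = 0 := by
  obtain ⟨κ, hκ⟩ := exists_forall_eq_of_separating
    ((pairing b ∘ₗ 𝒢 b).domRestrict₁₂ K K) (fun u hu => by
      by_contra hne
      have h := h𝒢.pos b u.1 fun h => hne (Subtype.ext h)
      exact h.ne' (hu u)) ((pairing b (𝒢 b v)).domRestrict K)
  refine ⟨κ.1, κ.2, fun w hw => ?_⟩
  have h : pairing b (𝒢 b κ.1) w = pairing b (𝒢 b v) w := hκ ⟨w, hw⟩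
  rw [map_sub, map_sub, LinearMap.sub_apply, h, sub_self]

/-- The Gram matrix of linearly independent vectors is invertible. -/
theorem det_gram_ne_zero (h𝒢 : IsGeneralizedMetric pairing SmoothOn 𝒢) {b : B} {n : ℕ}
    {u : Fin n → V b} (hu : LinearIndependent ℝ u) :
    (Matrix.of fun j i => pairing b (𝒢 b (u i)) (u j)).det ≠ 0 := by
  intro h
  obtain ⟨c, hc, hΓ⟩ := Matrix.exists_mulVec_eq_zero_iff.2 h
  refine hc (funext (Fintype.linearIndependent_iff.1 hu c ?_))
  by_contra hne
  refine (h𝒢.pos b _ hne).ne' ?_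
  have h1 : ∀ j, pairing b (𝒢 b (∑ i, c i • u i)) (u j) = 0 := fun j => by
    have := congrFun hΓ j
    simpa [Matrix.mulVec, dotProduct, mul_comm] using this
  rw [map_sum]
  exact Finset.sum_eq_zero fun j _ => by rw [map_smul, h1, smul_zero]

/-- This makes independence of a frame follow from an open condition on the base. -/
theorem linearIndependent_of_det_gram_ne_zero {b : B} {n : ℕ}
    {u : Fin n → V b} (h : (Matrix.of fun j i => pairing b (𝒢 b (u i)) (u j)).det ≠ 0) :
    LinearIndependent ℝ u := by
  refine Fintype.linearIndependent_iff.2 fun c hc => congrFun ?_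
  refine Matrix.eq_zero_of_mulVec_eq_zero h (funext fun j => ?_)
  have h1 : pairing b (𝒢 b (∑ i, c i • u i)) (u j) = 0 := by simp [hc]
  simpa [Matrix.mulVec, dotProduct, mul_comm] using h1

end IsGeneralizedMetric

namespace ExtendedAction

variable {m : ℕ} {M : Type*} [TopologicalSpace M] [ChartedSpace (EuclideanSpace ℝ (Fin m)) M]
  [IsManifold (𝓡 m) ∞ M]
  {F : Type*} [NormedAddCommGroup F] [NormedSpace ℝ F]
  {E : M → Type*} [TopologicalSpace (TotalSpace F E)] [∀ x, TopologicalSpace (E x)]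
  [∀ x, AddCommGroup (E x)] [∀ x, Module ℝ (E x)]
  [FiberBundle F E] [VectorBundle ℝ F E] [ContMDiffVectorBundle ∞ F E (𝓡 m)]
  {k : ℕ} {G : Type*} [TopologicalSpace G] [ChartedSpace (EuclideanSpace ℝ (Fin k)) G] [Group G]
  [LieGroup (𝓡 k) ∞ G] [MulAction G M]
  {𝔞 : Type*} [AddCommGroup 𝔞] [Module ℝ 𝔞]
  {C : CourantAlgebroid m F E} {A : CourantAlgebra (GroupLieAlgebra (𝓡 k) G) 𝔞}
  (S : ExtendedAction C A)
  {d : ℕ} {P : Type*} [TopologicalSpace P] [ChartedSpace (EuclideanSpace ℝ (Fin d)) P]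
  [MulAction G P] {ι : P → M} {𝒢 : ∀ x, E x →ₗ[ℝ] E x}

theorem mem_KG
    (h𝒢 : IsGeneralizedMetric C.pairing (SmoothSectionOn m F E) 𝒢)
    {x : M} {v : E x} : v ∈ S.KG 𝒢 x ↔ v ∈ S.Kperp x ∧ 𝒢 x v ∈ S.Kperp x := by
  have hsq := h𝒢.apply_apply (C.pairing_nondegenerate x)
  refine and_congr_right fun _ => ⟨?_, fun h => ⟨_, h, hsq v⟩⟩
  rintro ⟨w, hw, rfl⟩
  rwa [hsq]

theorem apply_mem_KG
    (h𝒢 : IsGeneralizedMetric C.pairing (SmoothSectionOn m F E) 𝒢)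
    {x : M} {v : E x} (hv : v ∈ S.KG 𝒢 x) : 𝒢 x v ∈ S.KG 𝒢 x := by
  rw [S.mem_KG h𝒢] at hv ⊢
  rw [h𝒢.apply_apply (C.pairing_nondegenerate x)]
  exact hv.symm

/-- Here `𝒢 v ∈ K^⊥` and `v ∈ K`, so `⟨𝒢 v, v⟩ = 0` and positivity applies. -/
theorem eq_zero_of_mem_KG_of_mem_K
    (h𝒢 : IsGeneralizedMetric C.pairing (SmoothSectionOn m F E) 𝒢)
    {x : M} {v : E x} (hv : v ∈ S.KG 𝒢 x) (hv' : v ∈ S.K x) :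
    v = 0 := by
  by_contra hne
  exact (h𝒢.pos x v hne).ne' (((S.mem_KG h𝒢).1 hv).2 v hv')

/-- `κ` is the projection of `v` to `K` for `⟨𝒢 ·, ·⟩`: orthogonality to `K` in this form says `𝒢 (v
- κ) ∈ K^⊥`, and isotropy keeps `v - κ` in `K^⊥`. -/
theorem exists_sub_mem_KG
    (h𝒢 : IsGeneralizedMetric C.pairing (SmoothSectionOn m F E) 𝒢)
    [FiniteDimensional ℝ F] {x : M} (hK : S.K x ≤ S.Kperp x) {v : E x}
    (hv : v ∈ S.Kperp x) : ∃ κ ∈ S.K x, v - κ ∈ S.KG 𝒢 x := by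
  have := finiteDimensional_fibre F E x
  obtain ⟨κ, hκ, h⟩ := h𝒢.exists_mem_forall_pairing_sub_eq_zero (S.K x) v
  exact ⟨κ, hκ, (S.mem_KG h𝒢).2 ⟨sub_mem hv (hK hκ), h⟩⟩

variable {S}

theorem exists_mem_KG_isProj
    (h𝒢 : IsGeneralizedMetric C.pairing (SmoothSectionOn m F E) 𝒢)
    [FiniteDimensional ℝ F] (hP : S.IsIntegralManifold d ι) {p : P}
    (hK : S.K (ι p) ≤ S.Kperp (ι p)) (s : RedFibre hP (quot G p)) :
    ∃ v ∈ S.KG 𝒢 (ι p), IsProj hP p v s := by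
  obtain ⟨v, hv, hs⟩ := exists_isProj_of_redFibre hP s
  obtain ⟨κ, hκ, h⟩ := S.exists_sub_mem_KG h𝒢 hK hv
  exact ⟨v - κ, h, hs.of_sub_mem ((S.mem_KG h𝒢).1 h).1 (by simpa using hκ)⟩

/-- The projection maps `K^𝒢` isomorphically to the reduced fibre. -/
theorem exists_equiv_KG
    (h𝒢 : IsGeneralizedMetric C.pairing (SmoothSectionOn m F E) 𝒢)
    [FiniteDimensional ℝ F] (hfree : ∀ (g : G) (p : P), g • p = p → g = 1)
    (hI : S.IsInvariantAlong ι) (hP : S.IsIntegralManifold d ι) (p : P)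
    (hK : S.K (ι p) ≤ S.Kperp (ι p)) :
    ∃ Φ : S.KG 𝒢 (ι p) ≃ₗ[ℝ] RedFibre hP (quot G p),
      ∀ v : S.KG 𝒢 (ι p), IsProj hP p (v : E (ι p)) (Φ v) := by
  choose Φ hΦ using fun v : S.KG 𝒢 (ι p) =>
    exists_isProj hfree hI hP p ((S.mem_KG h𝒢).1 v.2).1
  let Φ' : S.KG 𝒢 (ι p) →ₗ[ℝ] RedFibre hP (quot G p) :=
    { toFun := Φ
      map_add' := fun v w => isProj_unique hI (hΦ (v + w)) ((hΦ v).add (hΦ w))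
      map_smul' := fun c v => isProj_unique hI (hΦ (c • v)) ((hΦ v).smul c) }
  refine ⟨LinearEquiv.ofBijective Φ' ⟨fun v w h => ?_, fun s => ?_⟩, hΦ⟩
  · have hw : IsProj hP p w.1 (Φ v) := by
      rw [show Φ v = Φ w from h]
      exact hΦ w
    have h0 := S.eq_zero_of_mem_KG_of_mem_K h𝒢 (sub_mem v.2 w.2) ((hΦ v).sub_mem hw)
    exact Subtype.ext (sub_eq_zero.1 h0)
  · obtain ⟨v, hv, hs⟩ := exists_mem_KG_isProj h𝒢 hP hK s
    exact ⟨⟨v, hv⟩, isProj_unique hI (hΦ ⟨v, hv⟩) hs⟩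

end ExtendedAction

end GeneralizedMetric

/-! ### The reduced generalized metric. -/

section ReducedMetric

namespace ExtendedAction

variable {m : ℕ} {M : Type*} [TopologicalSpace M] [ChartedSpace (EuclideanSpace ℝ (Fin m)) M]
  [IsManifold (𝓡 m) ∞ M]
  {F : Type*} [NormedAddCommGroup F] [NormedSpace ℝ F]
  {E : M → Type*} [TopologicalSpace (TotalSpace F E)] [∀ x, TopologicalSpace (E x)]
  [∀ x, AddCommGroup (E x)] [∀ x, Module ℝ (E x)]
  [FiberBundle F E] [VectorBundle ℝ F E] [ContMDiffVectorBundle ∞ F E (𝓡 m)]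
  {k : ℕ} {G : Type*} [TopologicalSpace G] [ChartedSpace (EuclideanSpace ℝ (Fin k)) G] [Group G]
  [LieGroup (𝓡 k) ∞ G] [MulAction G M]
  {𝔞 : Type*} [AddCommGroup 𝔞] [Module ℝ 𝔞]
  {C : CourantAlgebroid m F E} {A : CourantAlgebra (GroupLieAlgebra (𝓡 k) G) 𝔞}
  {S : ExtendedAction C A}
  {d : ℕ} {P : Type*} [TopologicalSpace P] [ChartedSpace (EuclideanSpace ℝ (Fin d)) P]
  [MulAction G P] {ι : P → M} {𝒢 : ∀ x, E x →ₗ[ℝ] E x}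

theorem mk_sub {x y : M} {v v' : E x} {w w' : E y}
    (h : (⟨x, v⟩ : TotalSpace F E) = ⟨y, w⟩) (h' : (⟨x, v'⟩ : TotalSpace F E) = ⟨y, w'⟩) :
    (⟨x, v - v'⟩ : TotalSpace F E) = ⟨y, w - w'⟩ := by
  cases h; cases h'; rfl

theorem mk_apply_congr (𝒢 : ∀ x, E x →ₗ[ℝ] E x) {x y : M} {v : E x} {w : E y}
    (h : (⟨x, v⟩ : TotalSpace F E) = ⟨y, w⟩) :
    (⟨x, 𝒢 x v⟩ : TotalSpace F E) = ⟨y, 𝒢 y w⟩ := by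
  cases h; rfl

/-- `IsProj` for a point `p` of a given orbit `b`. -/
def IsProjAt (hP : S.IsIntegralManifold d ι) {b : MulAction.orbitRel.Quotient G P}
    (p : {p : P // quot G p = b}) (v : E (ι p)) (s : RedFibre hP b) : Prop :=
  ∃ hv : v ∈ S.Kperp (ι p), redEval hP p s = Submodule.Quotient.mk ⟨v, hv⟩

theorem IsProjAt.act (hI : S.IsInvariantAlong ι) {hP : S.IsIntegralManifold d ι}
    {b : MulAction.orbitRel.Quotient G P} {p q : {p : P // quot G p = b}} {v : E (ι p)}
    {w : E (ι q)} {s : RedFibre hP b} (hv : IsProjAt hP p v s) {g : G} (hg : q.1 = g • p.1)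
    (hw : (⟨ι q, w⟩ : TotalSpace F E) = ⟨g • ι p, S.act g (ι p) v⟩) : IsProjAt hP q w s := by
  obtain ⟨hv, hs⟩ := hv
  obtain ⟨v', w', hv', hw', h⟩ := s.2 g p q hg
  have hsub : v - v'.1 ∈ S.K (ι p) :=
    (Submodule.Quotient.eq ((S.K (ι p)).comap (S.Kperp (ι p)).subtype)).1 (hs.symm.trans hv')
  have hmk := mk_sub h hw
  rw [← map_sub] at hmk
  have hsub' : w'.1 - w ∈ S.K (ι q) := by
    refine S.mem_K_of_mk_eq hmk ((S.act_mem_K (hI.map_act g p)).2 ?_)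
    rw [← neg_sub]
    exact neg_mem hsub
  exact ⟨S.mem_Kperp_of_mk_eq hw ((S.act_mem_Kperp (hI.map_act g p)).2 hv),
    hw'.trans ((Submodule.Quotient.eq ((S.K (ι q)).comap (S.Kperp (ι q)).subtype)).2 hsub')⟩

/-- Over each orbit, `𝒢` on `K^𝒢` is conjugated by the isomorphism at one chosen point `p`. At
another point `q = g p` the vector is moved back by `g⁻¹`, treated at `p` and returned, which
changes nothing as `𝒢` commutes with the action. -/
theorem exists_descends [FiniteDimensional ℝ F]
    (h𝒢 : IsGeneralizedMetric C.pairing (SmoothSectionOn m F E) 𝒢) (hinv : S.Preserves 𝒢)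
    (hfree : ∀ (g : G) (p : P), g • p = p → g = 1)
    (hI : S.IsInvariantAlong ι) (hP : S.IsIntegralManifold d ι)
    (hK : ∀ p, S.K (ι p) ≤ S.Kperp (ι p)) :
    ∃ 𝒢red : ∀ b, RedFibre hP b →ₗ[ℝ] RedFibre hP b, Descends hP 𝒢 𝒢red := by
  have key : ∀ b : MulAction.orbitRel.Quotient G P, ∃ T : RedFibre hP b →ₗ[ℝ] RedFibre hP b,
      ∀ (q : {q : P // quot G q = b}), ∀ v ∈ S.KG 𝒢 (ι q), ∀ s, IsProjAt hP q v s →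
        IsProjAt hP q (𝒢 (ι q) v) (T s) := by
    intro b
    obtain ⟨p, rfl⟩ := Quotient.exists_rep b
    obtain ⟨Φ, hΦ⟩ := exists_equiv_KG h𝒢 hfree hI hP p (hK p)
    let R : S.KG 𝒢 (ι p) →ₗ[ℝ] S.KG 𝒢 (ι p) :=
      (𝒢 (ι p)).restrict fun v hv => S.apply_mem_KG h𝒢 hv
    refine ⟨Φ.toLinearMap ∘ₗ R ∘ₗ Φ.symm.toLinearMap, fun q v hv s hs => ?_⟩
    obtain ⟨g, hg⟩ := exists_smul_of_quot_eq q.2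
    have hg' : p = g⁻¹ • q.1 := by rw [hg, inv_smul_smul]
    obtain ⟨u, hu⟩ := exists_mk_eq (F := F)
      (show ι p = g⁻¹ • ι q by rw [← hP.equivariant, ← hg']) (S.act g⁻¹ (ι q) v)
    have hu𝒢 : (⟨ι p, 𝒢 (ι p) u⟩ : TotalSpace F E) =
        ⟨g⁻¹ • ι q, S.act g⁻¹ (ι q) (𝒢 (ι q) v)⟩ := by
      rw [← hinv]
      exact mk_apply_congr 𝒢 hu
    have hv' := (S.mem_KG h𝒢).1 hv
    have hact : ∀ {z}, S.act g⁻¹ (ι q) z ∈ S.Kperp (g⁻¹ • ι q) ↔ z ∈ S.Kperp (ι q) :=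
      S.act_mem_Kperp (hI.map_act g⁻¹ q)
    have huG : u ∈ S.KG 𝒢 (ι p) := (S.mem_KG h𝒢).2
      ⟨S.mem_Kperp_of_mk_eq hu (hact.2 hv'.1), S.mem_Kperp_of_mk_eq hu𝒢 (hact.2 hv'.2)⟩
    have hus : IsProj hP p u s := hs.act (q := ⟨p, rfl⟩) hI hg' hu
    have hsΦ : Φ.symm s = ⟨u, huG⟩ :=
      Φ.symm_apply_eq.2 (isProj_unique hI hus (hΦ ⟨u, huG⟩))
    have hT : IsProjAt hP (⟨p, rfl⟩ : {q : P // quot G q = quot G p}) (𝒢 (ι p) u)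
        (Φ (R (Φ.symm s))) := by
      rw [hsΦ]
      exact hΦ (R ⟨u, huG⟩)
    refine hT.act hI hg ?_
    rw [S.mk_act_congr g hu𝒢, ← S.mk_act_mul g g⁻¹ (mul_inv_cancel g).symm, S.act_one]
  choose T hT using key
  exact ⟨T, fun p v hv s hs => hT (quot G p) ⟨p, rfl⟩ v hv s hs⟩

section Descends

variable [FiniteDimensional ℝ F] {hP : S.IsIntegralManifold d ι}
  {𝒢red : ∀ b, RedFibre hP b →ₗ[ℝ] RedFibre hP b}

theorem Descends.unique (h𝒢 : IsGeneralizedMetric C.pairing (SmoothSectionOn m F E) 𝒢)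
    (hI : S.IsInvariantAlong ι) (hK : ∀ p, S.K (ι p) ≤ S.Kperp (ι p))
    (hred : Descends hP 𝒢 𝒢red) {𝒢' : ∀ b, RedFibre hP b →ₗ[ℝ] RedFibre hP b}
    (h' : Descends hP 𝒢 𝒢') : 𝒢' = 𝒢red := by
  funext b
  obtain ⟨p, rfl⟩ := Quotient.exists_rep b
  refine LinearMap.ext fun s => ?_
  obtain ⟨v, hv, hs⟩ := exists_mem_KG_isProj h𝒢 hP (hK p) s
  exact isProj_unique hI (h' p v hv s hs) (hred p v hv s hs)

theorem Descends.apply_apply (h𝒢 : IsGeneralizedMetric C.pairing (SmoothSectionOn m F E) 𝒢)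
    (hI : S.IsInvariantAlong ι) (hK : ∀ p, S.K (ι p) ≤ S.Kperp (ι p))
    (hred : Descends hP 𝒢 𝒢red) (b : MulAction.orbitRel.Quotient G P) (s : RedFibre hP b) :
    𝒢red b (𝒢red b s) = s := by
  obtain ⟨p, rfl⟩ := Quotient.exists_rep b
  obtain ⟨v, hv, hs⟩ := exists_mem_KG_isProj h𝒢 hP (hK p) s
  have h := hred p _ (S.apply_mem_KG h𝒢 hv) _ (hred p v hv s hs)
  rw [h𝒢.apply_apply (C.pairing_nondegenerate _)] at h
  exact isProj_unique hI h hs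

theorem Descends.eigenspace_isCompl
    (h𝒢 : IsGeneralizedMetric C.pairing (SmoothSectionOn m F E) 𝒢)
    (hI : S.IsInvariantAlong ι) (hK : ∀ p, S.K (ι p) ≤ S.Kperp (ι p))
    (hred : Descends hP 𝒢 𝒢red) (b : MulAction.orbitRel.Quotient G P) :
    IsCompl (Module.End.eigenspace (M := RedFibre hP b) (𝒢red b) (1 : ℝ))
      (Module.End.eigenspace (M := RedFibre hP b) (𝒢red b) (-1 : ℝ)) := by
  have hsq := hred.apply_apply h𝒢 hI hK b
  constructor
  · rw [Submodule.disjoint_def]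
    intro s h1 h2
    rw [Module.End.mem_eigenspace_iff] at h1 h2
    have h : (1 : ℝ) • s = (-1 : ℝ) • s := h1.symm.trans h2
    calc s = (1 / 2 : ℝ) • ((1 : ℝ) • s + (1 : ℝ) • s) := by module
      _ = (1 / 2 : ℝ) • ((1 : ℝ) • s + (-1 : ℝ) • s) := by rw [h]
      _ = 0 := by module
  · rw [codisjoint_iff, eq_top_iff]
    intro s _
    rw [Submodule.mem_sup]
    refine ⟨(1 / 2 : ℝ) • (s + 𝒢red b s), ?_, (1 / 2 : ℝ) • (s + (-1 : ℝ) • 𝒢red b s), ?_, ?_⟩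
    · rw [Module.End.mem_eigenspace_iff, map_smul, map_add, hsq, one_smul, add_comm]
    · rw [Module.End.mem_eigenspace_iff, map_smul, map_add, map_smul, hsq]
      module
    · module

/-- For a fixed class with representative `v ∈ K^𝒢`, the difference `𝒢 v - v` lies in `K^𝒢 ∩ K = 0`.
Conversely, an eigenvector of `𝒢` in `K^⊥` is automatically in `K^𝒢`. -/
theorem Descends.apply_eq_self_iff (h𝒢 : IsGeneralizedMetric C.pairing (SmoothSectionOn m F E) 𝒢)
    (hI : S.IsInvariantAlong ι) (hK : ∀ p, S.K (ι p) ≤ S.Kperp (ι p))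
    (hred : Descends hP 𝒢 𝒢red) (p : P) (s : RedFibre hP (quot G p)) :
    𝒢red (quot G p) s = s ↔ ∃ v, 𝒢 (ι p) v = v ∧ IsProj hP p v s := by
  constructor
  · intro h
    obtain ⟨v, hv, hs⟩ := exists_mem_KG_isProj h𝒢 hP (hK p) s
    have h1 := hred p v hv s hs
    rw [h] at h1
    refine ⟨v, sub_eq_zero.1 ?_, hs⟩
    exact S.eq_zero_of_mem_KG_of_mem_K h𝒢 (sub_mem (S.apply_mem_KG h𝒢 hv) hv) (h1.sub_mem hs)
  · rintro ⟨v, hv, hs⟩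
    have h1 := hred p v ((S.mem_KG h𝒢).2 ⟨hs.mem, hv.symm ▸ hs.mem⟩) s hs
    rw [hv] at h1
    exact isProj_unique hI h1 hs

theorem Descends.apply_eq_neg_iff (h𝒢 : IsGeneralizedMetric C.pairing (SmoothSectionOn m F E) 𝒢)
    (hI : S.IsInvariantAlong ι) (hK : ∀ p, S.K (ι p) ≤ S.Kperp (ι p))
    (hred : Descends hP 𝒢 𝒢red) (p : P) (s : RedFibre hP (quot G p)) :
    𝒢red (quot G p) s = -s ↔ ∃ v, 𝒢 (ι p) v = -v ∧ IsProj hP p v s := by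
  constructor
  · intro h
    obtain ⟨v, hv, hs⟩ := exists_mem_KG_isProj h𝒢 hP (hK p) s
    have h1 := hred p v hv s hs
    rw [h] at h1
    refine ⟨v, sub_eq_zero.1 ?_, hs⟩
    exact S.eq_zero_of_mem_KG_of_mem_K h𝒢 (sub_mem (S.apply_mem_KG h𝒢 hv) (neg_mem hv))
      (h1.sub_mem (hs.neg))
  · rintro ⟨v, hv, hs⟩
    have h1 := hred p v ((S.mem_KG h𝒢).2 ⟨hs.mem, hv.symm ▸ neg_mem hs.mem⟩) s hs
    rw [hv] at h1
    exact isProj_unique hI h1 (hs.neg)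

/-- Smooth sections of the reduced bundle are preserved by the reduced metric. -/
theorem Descends.smooth [T2Space M]
    (h𝒢 : IsGeneralizedMetric C.pairing (SmoothSectionOn m F E) 𝒢)
    (hI : S.IsInvariantAlong ι) (hK : ∀ p, S.K (ι p) ≤ S.Kperp (ι p))
    (hred : Descends hP 𝒢 𝒢red) {U : Set (MulAction.orbitRel.Quotient G P)}
    {σ : ∀ b, RedFibre hP b} (hσ : SmoothRedSectionOn hP U σ) :
    SmoothRedSectionOn hP U (fun b => 𝒢red b (σ b)) := by
  intro p₀ hp₀
  obtain ⟨W, hW, hp₀W, e, he, heσ⟩ := hσ p₀ hp₀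
  obtain ⟨n, hn⟩ := hI.rank
  have hfin : ∀ x : M, FiniteDimensional ℝ (E x) := finiteDimensional_fibre F E
  have hKspan : ∀ x, Submodule.span ℝ (range fun a => S.Ψ a x) = S.K x := fun x =>
    Submodule.span_eq (S.K x)
  -- The chosen `Ψ (a i)` form a basis of `K` at `p₀`, and `Γ` is their Gram matrix for `⟨𝒢 ·, ·⟩`.
  -- Where its determinant stays nonzero they are independent, and constant rank makes them a frame
  -- of `K`.
  obtain ⟨a, ha⟩ := exists_linearIndependent_comp_of_finrank_span (fun a => S.Ψ a (ι p₀))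
    (n := n) (by rw [hKspan, hn])
  let Γ : P → Matrix (Fin n) (Fin n) ℝ := fun p => Matrix.of fun j i =>
    C.pairing (ι p) (𝒢 (ι p) (S.Ψ (a i) (ι p))) (S.Ψ (a j) (ι p))
  have hι : ∀ p, ContMDiffAt (𝓡 d) (𝓡 m) ∞ ι p := fun p => hP.smooth.contMDiffAt
  have hΨ : ∀ b p, SmoothAlongAt m F d ι (fun p => S.Ψ b (ι p)) p := fun b p =>
    (S.Ψ b).contMDiff.contMDiffAt.comp p (hι p)
  have hΓ : ∀ p i j, ContMDiffAt (𝓡 d) 𝓘(ℝ, ℝ) ∞ (fun p => Γ p i j) p := fun p j i =>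
    C.contMDiffAt_pairing (hι p) (h𝒢.smoothAlongAt (hι p) (hΨ (a i) p)) (hΨ (a j) p)
  have hdet : Continuous fun p => (Γ p).det :=
    continuous_iff_continuousAt.2 fun p => (contMDiffAt_det (hΓ p)).continuousAt
  have hdet₀ : (Γ p₀).det ≠ 0 := h𝒢.det_gram_ne_zero ha
  let h : P → Fin n → ℝ := fun p j => C.pairing (ι p) (𝒢 (ι p) (e p)) (S.Ψ (a j) (ι p))
  -- Cramer's rule for `Γ c = h`: the coefficients of the metric projection of `e` to `K`, visibly
  -- smooth where `Γ` is invertible. Subtracting that projection gives the `K^𝒢`-component `v`, to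
  -- which `𝒢` may be applied.
  let c : Fin n → P → ℝ := fun i p => ((Γ p).det)⁻¹ * (Γ p).cramer (h p) i
  let v : ∀ p, E (ι p) := fun p => e p + ∑ i, (-c i p) • S.Ψ (a i) (ι p)
  refine ⟨W ∩ {p | (Γ p).det ≠ 0}, hW.inter (isOpen_ne_fun hdet continuous_const), ⟨hp₀W, hdet₀⟩,
    fun p => 𝒢 (ι p) (v p), ?_, ?_⟩
  · rintro p ⟨hpW, hpΓ⟩
    have hep : SmoothAlongAt m F d ι e p := he.contMDiffAt (hW.mem_nhds hpW)
    have hh : ∀ j, ContMDiffAt (𝓡 d) 𝓘(ℝ, ℝ) ∞ (fun p => h p j) p := fun j =>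
      C.contMDiffAt_pairing (hι p) (h𝒢.smoothAlongAt (hι p) hep) (hΨ (a j) p)
    have hc : ∀ i, ContMDiffAt (𝓡 d) 𝓘(ℝ, ℝ) ∞ (fun p => -c i p) p := fun i =>
      (((contMDiffAt_det (hΓ p)).inv₀ hpΓ).mul (contMDiffAt_cramer (hΓ p) hh i)).neg
    exact ContMDiffAt.contMDiffWithinAt (h𝒢.smoothAlongAt (hι p)
      (hep.add (hι p) (SmoothAlongAt.sum_smul (hι p) hc fun i => hΨ (a i) p)))
  · rintro p ⟨hpW, hpΓ⟩
    have hli : LinearIndependent ℝ fun i => S.Ψ (a i) (ι p) :=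
      IsGeneralizedMetric.linearIndependent_of_det_gram_ne_zero hpΓ
    have hspan : Submodule.span ℝ (range fun i => S.Ψ (a i) (ι p)) = S.K (ι p) := by
      refine Submodule.eq_of_le_of_finrank_eq ?_ ?_
      · rw [Submodule.span_le]
        rintro _ ⟨i, rfl⟩
        exact ⟨a i, rfl⟩
      · rw [finrank_span_eq_card hli, Fintype.card_fin, hn]
    have hsum : ∑ i, c i p • S.Ψ (a i) (ι p) ∈ S.K (ι p) :=
      Submodule.sum_mem _ fun i _ => Submodule.smul_mem _ _ ⟨a i, rfl⟩
    have hv : v p = e p - ∑ i, c i p • S.Ψ (a i) (ι p) := by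
      simp only [v, neg_smul, Finset.sum_neg_distrib, sub_eq_add_neg]
    have hep := heσ p hpW
    have hvperp : v p ∈ S.Kperp (ι p) := hv ▸ sub_mem hep.mem (hK p hsum)
    have hsolve : (Γ p).mulVec (fun i => c i p) = h p := by
      have h1 : (fun i => c i p) = ((Γ p).det)⁻¹ • (Γ p).cramer (h p) := rfl
      rw [h1, Matrix.mulVec_smul, Matrix.mulVec_cramer, smul_smul, inv_mul_cancel₀ hpΓ, one_smul]
    have hvj : ∀ j, C.pairing (ι p) (𝒢 (ι p) (v p)) (S.Ψ (a j) (ι p)) = 0 := fun j => by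
      have h1 := congrFun hsolve j
      simp only [Matrix.mulVec, dotProduct, Γ, Matrix.of_apply, h] at h1
      rw [hv]
      simp only [map_sub, map_sum, map_smul, LinearMap.sub_apply, LinearMap.sum_apply,
        LinearMap.smul_apply, smul_eq_mul, ← h1, mul_comm, sub_self]
    have hv𝒢 : 𝒢 (ι p) (v p) ∈ S.Kperp (ι p) := by
      have hle : S.K (ι p) ≤ LinearMap.ker (C.pairing (ι p) (𝒢 (ι p) (v p))) := by
        rw [← hspan, Submodule.span_le]
        rintro _ ⟨j, rfl⟩
        exact hvj j
      exact fun w hw => hle hw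
    refine hred p _ ((S.mem_KG h𝒢).2 ⟨hvperp, hv𝒢⟩) _ (hep.of_sub_mem hvperp ?_)
    rw [hv, sub_sub_cancel]
    exact hsum

theorem Descends.isGeneralizedMetric [T2Space M]
    (h𝒢 : IsGeneralizedMetric C.pairing (SmoothSectionOn m F E) 𝒢)
    (hI : S.IsInvariantAlong ι) (hK : ∀ p, S.K (ι p) ≤ S.Kperp (ι p))
    (hred : Descends hP 𝒢 𝒢red) :
    IsGeneralizedMetric (redPairing hP) (SmoothRedSectionOn hP) 𝒢red where
  orthogonal b s t := by
    obtain ⟨p, rfl⟩ := Quotient.exists_rep b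
    obtain ⟨v, hv, hs⟩ := exists_mem_KG_isProj h𝒢 hP (hK p) s
    obtain ⟨w, hw, ht⟩ := exists_mem_KG_isProj h𝒢 hP (hK p) t
    exact ((hred p v hv s hs).redPairing_eq (hred p w hw t ht)).trans
      ((h𝒢.orthogonal _ v w).trans (hs.redPairing_eq ht).symm)
  selfAdjoint b s t := by
    obtain ⟨p, rfl⟩ := Quotient.exists_rep b
    obtain ⟨v, hv, hs⟩ := exists_mem_KG_isProj h𝒢 hP (hK p) s
    obtain ⟨w, hw, ht⟩ := exists_mem_KG_isProj h𝒢 hP (hK p) t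
    exact ((hred p v hv s hs).redPairing_eq ht).trans
      ((h𝒢.selfAdjoint _ v w).trans (hs.redPairing_eq (hred p w hw t ht)).symm)
  pos b s hne := by
    obtain ⟨p, rfl⟩ := Quotient.exists_rep b
    obtain ⟨v, hv, hs⟩ := exists_mem_KG_isProj h𝒢 hP (hK p) s
    have hv0 : v ≠ 0 := by
      rintro rfl
      have h0 : IsProj hP p (0 : E (ι p)) 0 := ⟨zero_mem _, by rw [map_zero]; rfl⟩
      exact hne (isProj_unique hI hs h0)
    exact (h𝒢.pos _ v hv0).trans_eq ((hred p v hv s hs).redPairing_eq hs).symm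
  smooth U _ σ hσ := hred.smooth h𝒢 hI hK hσ

end Descends

end ExtendedAction

end ReducedMetric

/-! ### Assembly of the theorem. -/

theorem mainTheorem6
    -- the manifold `M` and the vector bundle `E → M`
    {m : ℕ} {M : Type*} [TopologicalSpace M] [ChartedSpace (EuclideanSpace ℝ (Fin m)) M]
    [IsManifold (𝓡 m) ∞ M] [T2Space M] [SecondCountableTopology M]
    {F : Type*} [NormedAddCommGroup F] [NormedSpace ℝ F] [FiniteDimensional ℝ F]
    {E : M → Type*} [TopologicalSpace (TotalSpace F E)] [∀ x, TopologicalSpace (E x)]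
    [∀ x, AddCommGroup (E x)] [∀ x, Module ℝ (E x)]
    [FiberBundle F E] [VectorBundle ℝ F E] [ContMDiffVectorBundle ∞ F E (𝓡 m)]
    -- the connected Lie group `G`, acting smoothly on `M`
    {k : ℕ} {G : Type*} [TopologicalSpace G] [ChartedSpace (EuclideanSpace ℝ (Fin k)) G] [Group G]
    [LieGroup (𝓡 k) ∞ G] [T2Space G] [SecondCountableTopology G] [ConnectedSpace G]
    [MulAction G M] [ContMDiffSMul (𝓡 k) (𝓡 m) ∞ G M]
    -- the exact Courant algebroid, the exact Courant algebra and the extended action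
    {𝔞 : Type*} [AddCommGroup 𝔞] [Module ℝ 𝔞]
    (C : CourantAlgebroid m F E) (hC : C.IsExact)
    (A : CourantAlgebra (GroupLieAlgebra (𝓡 k) G) 𝔞) (hA : A.IsExact)
    (S : ExtendedAction C A)
    -- the leaf `P`, on which `G` acts smoothly, freely and properly
    {d : ℕ} {P : Type*} [TopologicalSpace P] [ChartedSpace (EuclideanSpace ℝ (Fin d)) P]
    [IsManifold (𝓡 d) ∞ P] [T2Space P] [SecondCountableTopology P]
    [MulAction G P] [ContMDiffSMul (𝓡 k) (𝓡 d) ∞ G P] [ProperSMul G P]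
    (hfree : ∀ (g : G) (p : P), g • p = p → g = 1)
    {ι : P → M} (hP : S.IsIntegralManifold d ι)
    (hK : ∀ p, ∀ v ∈ S.K (ι p), ∀ w ∈ S.K (ι p), C.pairing (ι p) v w = 0)
    -- the invariant generalized metric
    (𝒢 : ∀ x, E x →ₗ[ℝ] E x)
    (h𝒢 : IsGeneralizedMetric C.pairing (SmoothSectionOn m F E) 𝒢)
    (hinv : S.Preserves 𝒢) :
    -- the reduced algebroid is exact
    (∀ p : P, ExtendedAction.RedIsExactAt hP p) ∧
    -- the projection `K^⊥ → E^red` is well defined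
    (∀ (p : P), ∀ v ∈ S.Kperp (ι p), ∃! s, ExtendedAction.IsProj hP p v s) ∧
    -- `K^𝒢` is `𝒢`-invariant and is mapped isomorphically to `E^red` by the projection
    (∀ p : P, (∀ v ∈ S.KG 𝒢 (ι p), 𝒢 (ι p) v ∈ S.KG 𝒢 (ι p)) ∧
      ∃ Φ : S.KG 𝒢 (ι p) ≃ₗ[ℝ] ExtendedAction.RedFibre hP (ExtendedAction.quot G p),
        ∀ v : S.KG 𝒢 (ι p), ExtendedAction.IsProj hP p (v : E (ι p)) (Φ v)) ∧
    -- there is exactly one operator on `E^red` that is the image of `𝒢` under this isomorphism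
    ∃ 𝒢red : ∀ b, ExtendedAction.RedFibre hP b →ₗ[ℝ] ExtendedAction.RedFibre hP b,
      ExtendedAction.Descends hP 𝒢 𝒢red ∧
      (∀ 𝒢', ExtendedAction.Descends hP 𝒢 𝒢' → 𝒢' = 𝒢red) ∧
      -- it is a generalized metric
      IsGeneralizedMetric (ExtendedAction.redPairing hP) (ExtendedAction.SmoothRedSectionOn hP)
        𝒢red ∧
      -- its `±1`-eigenspaces are the projections of `V_± ∩ K^⊥`, and `E^red` is their direct sum
      (∀ (p : P) s, 𝒢red (ExtendedAction.quot G p) s = s ↔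
        ∃ v, 𝒢 (ι p) v = v ∧ ExtendedAction.IsProj hP p v s) ∧
      (∀ (p : P) s, 𝒢red (ExtendedAction.quot G p) s = -s ↔
        ∃ v, 𝒢 (ι p) v = -v ∧ ExtendedAction.IsProj hP p v s) ∧
      (∀ b, IsCompl
        (Module.End.eigenspace (M := ExtendedAction.RedFibre hP b) (𝒢red b) (1 : ℝ))
        (Module.End.eigenspace (M := ExtendedAction.RedFibre hP b) (𝒢red b) (-1 : ℝ))) := by

  have hI := hP.isInvariantAlong hfree hC hA
  have hK' : ∀ p, S.K (ι p) ≤ S.Kperp (ι p) := fun p v hv w hw => hK p v hv w hw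
  obtain ⟨𝒢red, hred⟩ := ExtendedAction.exists_descends h𝒢 hinv hfree hI hP hK'
  refine ⟨fun p => ExtendedAction.redIsExactAt hfree hC hA hI hP p (hK' p), fun p v hv => ?_,
    fun p => ⟨fun v hv => S.apply_mem_KG h𝒢 hv,
      ExtendedAction.exists_equiv_KG h𝒢 hfree hI hP p (hK' p)⟩,
    𝒢red, hred, fun 𝒢' h' => hred.unique h𝒢 hI hK' h', hred.isGeneralizedMetric h𝒢 hI hK',
    hred.apply_eq_self_iff h𝒢 hI hK', hred.apply_eq_neg_iff h𝒢 hI hK',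
    hred.eigenspace_isCompl h𝒢 hI hK'⟩
  obtain ⟨s, hs⟩ := ExtendedAction.exists_isProj hfree hI hP p hv
  exact ⟨s, hs, fun t ht => ExtendedAction.isProj_unique hI ht hs⟩
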